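/- **Setting.** Let $f:\mathbb R^d\to\mathbb R$ be twice continuously differentiable and bounded below, with $f^\star=\inf f$, gradient $\mathbf g(\mathbf x)$ and Hessian $\mathbf H(\mathbf x)$. Suppose $\|\mathbf H(\mathbf x)\|\le L_{\mathbf g}$ and $\|\mathbf H(\mathbf x)-\mathbf H(\mathbf y)\|\le L_{\mathbf H}\|\mathbf x-\mathbf y\|$ for all $\mathbf x,\mathbf y$. An inexact Hessian $\bar{\mathbf H}(\mathbf x)=\mathbf H(\mathbf x)+\mathbf E(\mathbf x)$ is available, where $\mathbf E(\mathbf x)$ is symmetric and $\|\mathbf E(\mathbf x)\|\le\varepsilon$. **Algorithm 1 (Newton-MR with inexact Hessian).** The inputs are $\mathbf x_0$, $0<\varepsilon_{\mathbf g}\le 1$, $\eta=\theta\sqrt{\varepsilon_{\mathbf g}}$ with $\theta>0$, $0<\rho_S<1/2$, $0<\rho_N<1$, a line-search factor $0<h<1$ and an initial forward step $\alpha^{(0)}>0$. While $\|\mathbf g_k\|>\varepsilon_{\mathbf g}$, where $\mathbf g_k=\mathbf g(\mathbf x_k)$ and $\bar{\mathbf H}_k=\bar{\mathbf H}(\mathbf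 x_k)$, do the following. 1. Run MINRES (Lanczos recurrence with Givens-type reflections) on $\bar{\mathbf H}_k\mathbf s\approx-\mathbf g_k$. Iteration $t$ makes one product, of $\bar{\mathbf H}_k$ with the Lanczos vector $\mathbf v_t$. Let $\mathbf s^{(t-1)}$ be the iterate and $\mathbf r^{(t-1)}=-\bar{\mathbf H}_k\mathbf s^{(t-1)}-\mathbf g_k$ its residual. In iteration $t=1,2,\dots$, first, if $\|\bar{\mathbf H}_k\mathbf r^{(t-1)}\|<\eta\|\bar{\mathbf H}_k\mathbf s^{(t-1)}\|$ (inexactness condition), return $\mathbf d_k=\mathbf s^{(t-1)}$ with type SOL. Otherwise, if $\langle\mathbf r^{(t-1)},\bar{\mathbf H}_k\mathbf r^{(t-1)}\rangle\le 0$ (NPC condition), return $\mathbf d_k=\mathbf r^{(t-1)}$ with type NPC. 2. Choose $\alpha_k$ with $f(\mathbf x_k+\alpha_k\mathbf d_k)\le f(\mathbf x_k)+\rho\alpha_k\langle\mathbf g_k,\mathbf d_k\rangle$. For type SOL, take $\rho=\rho_S$ and backtrack $\alpha=1,h,h^2,\dots$ to the first acceptable step. For type NPC, take $\rho=\rho_N$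 and start at $\alpha^{(0)}$: if it is acceptable, divide the step by $h$ as long as it stays acceptable and keep the last acceptable step; if not, backtrack from $1$. 3. Set $\mathbf x_{k+1}=\mathbf x_k+\alpha_k\mathbf d_k$. **Regularity assumptions.** Let $\sigma,\omega>0$. * For every $\mathbf x$ and $t$: if MINRES for $(\bar{\mathbf H}(\mathbf x),\mathbf g(\mathbf x))$ has not detected the NPC condition in iterations $1,\dots,t$, then $\mathbf T_t=\mathbf V_t^\top\bar{\mathbf H}(\mathbf x)\mathbf V_t\succeq\sigma\mathbf I$, where $\mathbf V_t=[\mathbf v_1,\dots,\mathbf v_t]$. * At every iterate of Algorithm 1 with type NPC, the direction satisfies $\|\mathbf d_k\|\ge\omega\|\mathbf g_k\|$. **Spectral and spectral-gap assumptions.** An eigenvalue of $\mathbf H$ is $\mathbf g$-relevant if its eigenspace is not orthogonal to $\mathbf g$. For a set $I$ of reals let $\Pi_I$ be the orthogonal projection on the span of the projections of $\mathbf g$ on the eigenspaces of $\mathbf H$ with eigenvalue in $I$. Let $\mu,\delta>0$ and $L_{\mathbf g}^2/(L_{\mathbf g}^2+\eta^2)<\nu\le1$. At every $\mathbf x$ with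 $\mathbf H\mathbf g\ne\mathbf 0$, at least one of the following holds: * (i) there are $\mathbf g$-relevant eigenvalues $\zeta>0>\zeta'$ with $\min\{\zeta,|\zeta'|\}\ge\mu$ and $\|(\Pi_{[\zeta,\infty)}+\Pi_{(-\infty,\zeta']})\mathbf g\|^2\ge\nu\|\Pi_{\mathbb R\setminus\{0\}}\mathbf g\|^2$, such that the next smaller eigenvalue of $\mathbf H$ below $\zeta$ and the next larger one above $\zeta'$ (if they exist) are at distance at least $\delta$ from $\zeta$ and $\zeta'$, respectively; * (ii) there is a $\mathbf g$-relevant $\zeta\ge\mu$ with $\|\Pi_{[\zeta,\infty)}\mathbf g\|^2\ge\nu\|\Pi_{\mathbb R\setminus\{0\}}\mathbf g\|^2$ whose next smaller eigenvalue of $\mathbf H$ (if any) is at distance at least $\delta$; * (iii) there is a $\mathbf g$-relevant $\zeta'\le-\mu$ with $\|\Pi_{(-\infty,\zeta']}\mathbf g\|^2\ge\nu\|\Pi_{\mathbb R\setminus\{0\}}\mathbf g\|^2$ whose next larger eigenvalue of $\mathbf H$ (if any) is at distance at least $\delta$. **Theorem (operation complexity of Algorithm 1).** Under these assumptions suppose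 that $$\varepsilon\le\min\Big\{\frac{\sqrt{\varepsilon_{\mathbf g}}}{\eta+\sigma},\ \frac{\sigma(1-2\rho_S)}{2},\ 1-\rho_N,\ \frac{\sqrt\nu\,\sigma}{2(\sqrt\nu+4\delta L_{\mathbf g})},\ \frac{\mu}{2}\Big\}.$$ Then Algorithm 1 terminates at a point with $\|\mathbf g(\mathbf x)\|\le\varepsilon_{\mathbf g}$ after at most $\tilde{\mathcal O}(\varepsilon_{\mathbf g}^{-3/2})$ gradient and Hessian-vector product evaluations. Precisely, there are $C>0$ and $p\in\mathbb N$, depending only on $L_{\mathbf g},L_{\mathbf H},\sigma,\omega,\mu,\delta,\theta,\rho_S,\rho_N,h,\alpha^{(0)}$ (not on $d,f,\bar{\mathbf H},\mathbf x_0,\varepsilon_{\mathbf g},\varepsilon,\nu$), such that the total number of gradient evaluations and of products with $\bar{\mathbf H}$ is at most $$C\,\big(1+f(\mathbf x_0)-f^\star\big)\,\varepsilon_{\mathbf g}^{-3/2}\,\big(1+\log(1/\varepsilon_{\mathbf g})\big)^p .$$ -/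

import Mathlib

open scoped InnerProductSpace Gradient

/-- The space `ℝ^d` with its Euclidean norm. -/
abbrev Vec (d : ℕ) := EuclideanSpace ℝ (Fin d)

/-- The Hessian of `f` at `x`, as a linear operator. -/
noncomputable def hess {d : ℕ} (f : Vec d → ℝ) (x : Vec d) : Vec d →L[ℝ] Vec d :=
  fderiv ℝ (gradient f) x

/-! ### MINRES -/

/-- The variables of MINRES at the beginning of iteration `t`. -/
structure MinresState (d : ℕ) where
  /-- the Lanczos vector `v_t` -/
  v : Vec d
  /-- the Lanczos vector `v_{t-1}` -/
  vPrev : Vec d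
  /-- `w_{t-1}` -/
  w : Vec d
  /-- `w_{t-2}` -/
  wPrev : Vec d
  /-- the iterate `s_{t-1}` -/
  iter : Vec d
  /-- the residual `r_{t-1}` -/
  res : Vec d
  /-- `β_t` -/
  beta : ℝ
  /-- the reflection coefficient `c_{t-1}` -/
  c : ℝ
  /-- the reflection coefficient `s_{t-1}` -/
  s : ℝ
  /-- `φ_{t-1}` -/
  phi : ℝ
  /-- `δ_t^{(1)}` -/
  delta : ℝ
  /-- `ϵ_t` -/
  eps : ℝ

namespace MinresState

variable {d : ℕ} (A : Vec d →L[ℝ] Vec d) (S : MinresState d)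

/-- The state before the first iteration, for the right-hand side `-g`. -/
noncomputable def start (g : Vec d) : MinresState d where
  v := ‖g‖⁻¹ • (-g)
  vPrev := 0
  w := 0
  wPrev := 0
  iter := 0
  res := -g
  beta := ‖g‖
  c := -1
  s := 0
  phi := ‖g‖
  delta := 0
  eps := 0

/-- `α_t = ⟨v_t, A v_t⟩`. The vector `A v_t` is the only matrix-vector product of iteration `t`. -/
noncomputable def alpha : ℝ := ⟪S.v, A S.v⟫_ℝ

/-- `q_t = A v_t - β_t v_{t-1} - α_t v_t`. -/
noncomputable def q : Vec d := A S.v - S.beta • S.vPrev - S.alpha A • S.v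

/-- `β_{t+1} = ‖q_t‖`. -/
noncomputable def betaNext : ℝ := ‖S.q A‖

/-- `δ_t^{(2)}`. -/
noncomputable def delta2 : ℝ := S.c * S.delta + S.s * S.alpha A

/-- `γ_t^{(1)}`. -/
noncomputable def gamma1 : ℝ := S.s * S.delta - S.c * S.alpha A

/-- `ϵ_{t+1}`. -/
noncomputable def epsNext : ℝ := S.s * S.betaNext A

/-- `δ_{t+1}^{(1)}`. -/
noncomputable def deltaNext : ℝ := -S.c * S.betaNext A

/-- `γ_t^{(2)}`. -/
noncomputable def gamma2 : ℝ := √(S.gamma1 A ^ 2 + S.betaNext A ^ 2)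

/-- The inexactness test of iteration `t`: it is the scalar form of
`‖A r_{t-1}‖ < η ‖A s_{t-1}‖`. Here `phi0 = ‖g‖`. -/
def SolTest (phi0 η : ℝ) : Prop :=
  S.phi * √(S.gamma1 A ^ 2 + S.deltaNext A ^ 2) < η * √(phi0 ^ 2 - S.phi ^ 2)

/-- The nonpositive curvature test of iteration `t`: it is the scalar form of
`⟨r_{t-1}, A r_{t-1}⟩ ≤ 0`. -/
def NpcTest : Prop := 0 ≤ S.c * S.gamma1 A

open Classical in
/-- The update at the end of iteration `t`, when neither test has stopped the process.
If `β_{t+1} = 0` the Lanczos process is exhausted and `v_{t+1}` is set to `0`. -/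
noncomputable def next : MinresState d :=
  let c' : ℝ := if S.gamma2 A = 0 then 0 else S.gamma1 A / S.gamma2 A
  let s' : ℝ := if S.gamma2 A = 0 then 1 else S.betaNext A / S.gamma2 A
  let phi' : ℝ := if S.gamma2 A = 0 then S.phi else s' * S.phi
  let w' : Vec d :=
    if S.gamma2 A = 0 then S.w
    else (S.gamma2 A)⁻¹ • (S.v - S.delta2 A • S.w - S.eps • S.wPrev)
  let v' : Vec d := (S.betaNext A)⁻¹ • S.q A
  { v := v'
    vPrev := S.v
    w := w'
    wPrev := S.w
    iter := if S.gamma2 A = 0 then S.iter else S.iter + (c' * S.phi) • w'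
    res := if S.gamma2 A = 0 then S.res else s' ^ 2 • S.res - (phi' * c') • v'
    beta := S.betaNext A
    c := c'
    s := s'
    phi := phi'
    delta := S.deltaNext A
    eps := S.epsNext A }

end MinresState

/-- `minresState A g n` is the state of MINRES after `n` full iterations, that is, at the
beginning of iteration `n + 1`. -/
noncomputable def minresState {d : ℕ} (A : Vec d →L[ℝ] Vec d) (g : Vec d) : ℕ → MinresState d
  | 0 => MinresState.start g
  | n + 1 => (minresState A g n).next A

/-- Iteration `n + 1` of MINRES triggers the inexactness condition. -/
def SolAt {d : ℕ} (A : Vec d →L[ℝ] Vec d) (g : Vec d) (η : ℝ) (n : ℕ) : Prop :=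
  (minresState A g n).SolTest A ‖g‖ η

/-- Iteration `n + 1` of MINRES triggers the nonpositive curvature condition. -/
def NpcAt {d : ℕ} (A : Vec d →L[ℝ] Vec d) (g : Vec d) (n : ℕ) : Prop :=
  (minresState A g n).NpcTest A

/-- MINRES passes through its first `n` iterations without returning. -/
def NotStoppedBefore {d : ℕ} (A : Vec d →L[ℝ] Vec d) (g : Vec d) (η : ℝ) (n : ℕ) : Prop :=
  ∀ j < n, ¬ SolAt A g η j ∧ ¬ NpcAt A g j

/-- `MINRES(A, g, η)` returns in its iteration `n + 1`, hence after `n + 1` products with `A`,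
with `Type = SOL` and the direction `s_n`. -/
def ReturnsSol {d : ℕ} (A : Vec d →L[ℝ] Vec d) (g : Vec d) (η : ℝ) (n : ℕ) (dir : Vec d) : Prop :=
  NotStoppedBefore A g η n ∧ SolAt A g η n ∧ dir = (minresState A g n).iter

/-- `MINRES(A, g, η)` returns in its iteration `n + 1`, hence after `n + 1` products with `A`,
with `Type = NPC` and the direction `r_n`; the inexactness test comes first. -/
def ReturnsNpc {d : ℕ} (A : Vec d →L[ℝ] Vec d) (g : Vec d) (η : ℝ) (n : ℕ) (dir : Vec d) : Prop :=
  NotStoppedBefore A g η n ∧ ¬ SolAt A g η n ∧ NpcAt A g n ∧ dir = (minresState A g n).res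

/-- The matrix `T_t = V_tᵀ A V_t`, where `V_t = [v_1, …, v_t]` holds the Lanczos vectors. -/
noncomputable def lanczosMatrix {d : ℕ} (A : Vec d →L[ℝ] Vec d) (g : Vec d) (t : ℕ) :
    Matrix (Fin t) (Fin t) ℝ :=
  Matrix.of fun i j => ⟪(minresState A g i).v, A (minresState A g j).v⟫_ℝ

/-! ### Line searches -/

/-- The Armijo condition for the step size `α` along `p`. -/
def Armijo {d : ℕ} (f : Vec d → ℝ) (x p : Vec d) (ρ α : ℝ) : Prop :=
  f (x + α • p) ≤ f x + ρ * α * ⟪gradient f x, p⟫_ℝ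

/-- Backward tracking, started at step size `1` with factor `h`, returns `α`. -/
def BackTracking {d : ℕ} (f : Vec d → ℝ) (x p : Vec d) (ρ h α : ℝ) : Prop :=
  ∃ n : ℕ, (∀ m < n, ¬ Armijo f x p ρ (h ^ m)) ∧ Armijo f x p ρ (h ^ n) ∧ α = h ^ n

/-- Forward/backward tracking, with initial step size `α₀` and factor `h`, returns `α`: if `α₀` is
not acceptable, backward tracking is called; otherwise the step size is divided by `h` as long as
it is acceptable, and the last acceptable one is returned. -/
def ForwardBackTracking {d : ℕ} (f : Vec d → ℝ) (x p : Vec d) (ρ h α₀ α : ℝ) : Prop :=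
  (¬ Armijo f x p ρ α₀ ∧ BackTracking f x p ρ h α) ∨
    ∃ n : ℕ, (∀ m ≤ n, Armijo f x p ρ (α₀ / h ^ m)) ∧ ¬ Armijo f x p ρ (α₀ / h ^ (n + 1)) ∧
      α = h * (α₀ / h ^ (n + 1))

/-! ### Newton-MR with inexact Hessian -/

/-- The input of Newton-MR with inexact Hessian: the objective, the inexact Hessian, the initial
point, the tolerances `εg` and `η`, and the line-search parameters. -/
structure NewtonMRInput (d : ℕ) where
  f : Vec d → ℝ
  Hbar : Vec d → (Vec d →L[ℝ] Vec d)
  x₀ : Vec d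
  εg : ℝ
  η : ℝ
  ρS : ℝ
  ρN : ℝ
  h : ℝ
  α₀ : ℝ

/-- `Reaches P m n x`: the execution of Newton-MR on the input `P` arrives at the head of its main
loop with the iterate `x`, having by then made `m` gradient evaluations (including the one at `x`)
and `n` products of a vector with an inexact Hessian. The loop is left at `x` when
`‖∇f(x)‖ ≤ εg`. -/
inductive Reaches {d : ℕ} (P : NewtonMRInput d) : ℕ → ℕ → Vec d → Prop
  | first : Reaches P 1 0 P.x₀
  | solStep {m n t : ℕ} {x p : Vec d} {α : ℝ} (hx : Reaches P m n x)
      (hg : P.εg < ‖gradient P.f x‖)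
      (hp : ReturnsSol (P.Hbar x) (gradient P.f x) P.η t p)
      (hα : BackTracking P.f x p P.ρS P.h α) :
      Reaches P (m + 1) (n + (t + 1)) (x + α • p)
  | npcStep {m n t : ℕ} {x p : Vec d} {α : ℝ} (hx : Reaches P m n x)
      (hg : P.εg < ‖gradient P.f x‖)
      (hp : ReturnsNpc (P.Hbar x) (gradient P.f x) P.η t p)
      (hα : ForwardBackTracking P.f x p P.ρN P.h P.α₀ α) :
      Reaches P (m + 1) (n + (t + 1)) (x + α • p)

/-! ### Assumptions -/

/-- Hessian boundedness. -/
def HessianBounded {d : ℕ} (f : Vec d → ℝ) (Lg : ℝ) : Prop :=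
  ContDiff ℝ 2 f ∧ ∀ x, ‖hess f x‖ ≤ Lg

/-- Lipschitz continuity of the Hessian. -/
def HessianLipschitz {d : ℕ} (f : Vec d → ℝ) (LH : ℝ) : Prop :=
  ∀ x y, ‖hess f x - hess f y‖ ≤ LH * ‖x - y‖

/-- The noise model: `Hbar(x) = ∇²f(x) + E(x)` with `E(x)` symmetric and `‖E(x)‖ ≤ ε`. -/
def NoiseModel {d : ℕ} (f : Vec d → ℝ) (Hbar : Vec d → (Vec d →L[ℝ] Vec d)) (ε : ℝ) : Prop :=
  ∃ E : Vec d → (Vec d →L[ℝ] Vec d),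
    ∀ x, Hbar x = hess f x + E x ∧ IsSelfAdjoint (E x) ∧ ‖E x‖ ≤ ε

/-- Krylov subspace regularity: at every point, as long as the nonpositive curvature condition has
not been detected in the iterations `1, …, t`, one has `T_t ⪰ σ I`. -/
def KrylovRegular {d : ℕ} (f : Vec d → ℝ) (Hbar : Vec d → (Vec d →L[ℝ] Vec d)) (σ : ℝ) : Prop :=
  ∀ (x : Vec d) (t : ℕ), (∀ j < t, ¬ NpcAt (Hbar x) (gradient f x) j) →
    (lanczosMatrix (Hbar x) (gradient f x) t - σ • (1 : Matrix (Fin t) (Fin t) ℝ)).PosSemidef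

/-- At the iterates of the algorithm, the nonpositive curvature directions `p = r_k^{(t-1)}`
satisfy `‖p‖ ≥ ω ‖∇f(x_k)‖`. -/
def NpcRegular {d : ℕ} (P : NewtonMRInput d) (ω : ℝ) : Prop :=
  ∀ (m n t : ℕ) (x p : Vec d), Reaches P m n x → P.εg < ‖gradient P.f x‖ →
    ReturnsNpc (P.Hbar x) (gradient P.f x) P.η t p → ω * ‖gradient P.f x‖ ≤ ‖p‖

section Spectral

variable {d : ℕ} (H : Vec d →L[ℝ] Vec d) (g : Vec d)

/-- `z` is a `g`-relevant eigenvalue of `H`: some eigenvector is not orthogonal to `g`. -/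
def IsRelevant (z : ℝ) : Prop :=
  ∃ u : Vec d, Module.End.HasEigenvector (H : Vec d →ₗ[ℝ] Vec d) z u ∧ ⟪u, g⟫_ℝ ≠ 0

/-- The component of `g` in the eigenspace of `z`. When `z` is `g`-relevant, this is (up to
scaling) the one vector that is not orthogonal to `g` in an orthogonal basis of the eigenspace
that has only one such vector. -/
noncomputable def eigenComponent (z : ℝ) : Vec d :=
  (Module.End.eigenspace (H : Vec d →ₗ[ℝ] Vec d) z).starProjection g

/-- The orthogonal projection of `g` on the span of those `g`-relevant eigenvectors of `H`
whose eigenvalues lie in `I`. -/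
noncomputable def relevantProj (I : Set ℝ) : Vec d :=
  (Submodule.span ℝ (eigenComponent H g '' I)).starProjection g

/-- `S Sᵀ g`, where `S` holds the eigenvectors of the nonzero `g`-relevant eigenvalues. -/
noncomputable def projNonzero : Vec d := relevantProj H g {z | z ≠ 0}

/-- `S_{k+} S_{k+}ᵀ g` for the positive `g`-relevant eigenvalue `z = ζ_k`: the eigenvectors of the
`k` largest ones, `ζ_1, …, ζ_k`, are used. -/
noncomputable def projUpper (z : ℝ) : Vec d := relevantProj H g (Set.Ici z)

/-- `S_{l-} S_{l-}ᵀ g` for the negative `g`-relevant eigenvalue `z = ζ_l`: the eigenvectors of the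
most negative ones, `ζ_l, …, ζ_φ`, are used. -/
noncomputable def projLower (z : ℝ) : Vec d := relevantProj H g (Set.Iic z)

/-- The next smaller eigenvalue of `H` (relevant or not), if there is one, is at distance at
least `δ` from `z`. -/
def GapBelow (δ z : ℝ) : Prop :=
  ∀ z' : ℝ, Module.End.HasEigenvalue (H : Vec d →ₗ[ℝ] Vec d) z' → z' < z → δ ≤ z - z'

/-- The next larger eigenvalue of `H` (relevant or not), if there is one, is at distance at
least `δ` from `z`. -/
def GapAbove (δ z : ℝ) : Prop :=
  ∀ z' : ℝ, Module.End.HasEigenvalue (H : Vec d →ₗ[ℝ] Vec d) z' → z < z' → δ ≤ z' - z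

/-- The spectral condition and the spectral gap condition at one point; the second concerns the
eigenvalues that the first provides. -/
def SpectralCondition (μ ν δ : ℝ) : Prop :=
  (∃ zk zl : ℝ, (IsRelevant H g zk ∧ 0 < zk) ∧ (IsRelevant H g zl ∧ zl < 0) ∧
      μ ≤ min zk |zl| ∧
      ν * ‖projNonzero H g‖ ^ 2 ≤ ‖projUpper H g zk + projLower H g zl‖ ^ 2 ∧
      GapBelow H δ zk ∧ GapAbove H δ zl) ∨
  (∃ zk : ℝ, (IsRelevant H g zk ∧ 0 < zk) ∧ μ ≤ zk ∧
      ν * ‖projNonzero H g‖ ^ 2 ≤ ‖projUpper H g zk‖ ^ 2 ∧ GapBelow H δ zk) ∨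
  (∃ zl : ℝ, (IsRelevant H g zl ∧ zl < 0) ∧ μ ≤ |zl| ∧
      ν * ‖projNonzero H g‖ ^ 2 ≤ ‖projLower H g zl‖ ^ 2 ∧ GapAbove H δ zl)

end Spectral

/-- The spectral assumption together with the spectral gap assumption, at every point whose
gradient is not in the null space of the exact Hessian. -/
def SpectralRegular {d : ℕ} (f : Vec d → ℝ) (μ ν δ : ℝ) : Prop :=
  ∀ x, hess f x (gradient f x) ≠ 0 → SpectralCondition (hess f x) (gradient f x) μ ν δ

/-! Put e = √εg. Up to a bounded number of steps, every two steps together lower f by a fixed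
multiple of e³, so O(e⁻³) steps suffice; each costs one gradient and O(1 + log(1/εg)) products.

Decrease. A rejected trial step must be defeated either by the Hessian error ε ≤ e/σ or by the cubic
Taylor remainder. Along an NPC direction, of norm at least ω e², both cases give a decrease of order
e³ (`le_of_not_armijo`). Along a SOL direction s the curvature is at least σ, so the step also pays
unless it is a full step with ‖s‖ ≤ c e (`solution_step_decrease`).

Short full steps. The inexactness condition bounds A(g + A s), so by Taylor expansion A'g' is small
at the new point: unless ‖g'‖ ≤ εg, the curvature along g' is below σ
(`inner_gradient_lt_of_small_step`). Krylov regularity for t = 1 then forces NPC detection in the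
first iteration, so the next step is an NPC step and pays for both (`Reaches.potential`).

Inner cost. MINRES residuals are minimal over Krylov spaces on which A ⪰ σ, hence decay
geometrically, while ‖A s‖ stays comparable to ‖g‖; the inexactness condition holds after
logarithmically many iterations (`notStoppedBefore_le_log`). All this needs the scalar recurrences
to compute the true residuals and tests, which is the content of `MinresInvariant`. -/

/-! ### Lanczos vectors and the correctness of MINRES -/

section Minres

variable {d : ℕ} {A : Vec d →L[ℝ] Vec d} {g : Vec d}

/-- The three-term recurrence of the Lanczos vectors. -/
theorem MinresState.apply_v (S : MinresState d) :
    A S.v = S.betaNext A • (S.next A).v + S.alpha A • S.v + S.beta • S.vPrev := by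
  have h : S.betaNext A • (S.next A).v = S.q A := by
    by_cases h0 : S.betaNext A = 0
    · rw [h0, zero_smul, norm_eq_zero.1 (show ‖S.q A‖ = 0 from h0)]
    · exact smul_inv_smul₀ h0 _
  rw [h, MinresState.q]
  abel

theorem minresState_norm_v {n : ℕ} (h : (minresState A g n).beta ≠ 0) :
    ‖(minresState A g n).v‖ = 1 := by
  cases n with
  | zero =>
    have h' : ‖g‖ ≠ 0 := h
    change ‖‖g‖⁻¹ • (-g)‖ = 1
    rw [norm_smul, norm_neg, norm_inv, norm_norm, inv_mul_cancel₀ h']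
  | succ n =>
    have h' : ‖(minresState A g n).q A‖ ≠ 0 := h
    change ‖‖(minresState A g n).q A‖⁻¹ • (minresState A g n).q A‖ = 1
    rw [norm_smul, norm_inv, norm_norm, inv_mul_cancel₀ h']

theorem minresState_of_beta_eq_zero {n : ℕ} (h : (minresState A g n).beta = 0) :
    (minresState A g n).v = 0 ∧ (minresState A g n).delta = 0 := by
  cases n with
  | zero =>
    have h' : g = 0 := norm_eq_zero.1 h
    subst h'
    simp [minresState, MinresState.start]
  | succ n =>
    have h' : (minresState A g n).betaNext A = 0 := h
    refine ⟨?_, ?_⟩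
    · change ((minresState A g n).betaNext A)⁻¹ • (minresState A g n).q A = 0
      rw [h', inv_zero, zero_smul]
    · change -(minresState A g n).c * (minresState A g n).betaNext A = 0
      rw [h', mul_zero]

/-- Both `v` and `delta` vanish, hence so does `gamma1`, and the test reads `0 ≤ 0`.
Contrapositively, nondetection keeps the Lanczos process alive. -/
theorem npcAt_of_beta_eq_zero {n : ℕ} (h : (minresState A g n).beta = 0) : NpcAt A g n := by
  obtain ⟨h1, h2⟩ := minresState_of_beta_eq_zero h
  simp [NpcAt, MinresState.NpcTest, MinresState.gamma1, MinresState.alpha, h1, h2]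

/-- By symmetry `A` moves onto the earlier vector, where the three-term recurrence leaves only the
neighbouring coefficient, cancelled by the subtraction in `q`. The last vector may be zero: only
earlier `beta` must not vanish. -/
theorem minresState_inner_v (hA : ∀ x y : Vec d, ⟪A x, y⟫_ℝ = ⟪x, A y⟫_ℝ) {n : ℕ}
    (h : ∀ j < n, (minresState A g j).beta ≠ 0) :
    ∀ i < n, ⟪(minresState A g i).v, (minresState A g n).v⟫_ℝ = 0 := by
  induction n using Nat.strong_induction_on with
  | _ n ih =>
  cases n with
  | zero => intro i hi; omega
  | succ n =>
    have orth : ∀ i j, i < j → j ≤ n →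
        ⟪(minresState A g i).v, (minresState A g j).v⟫_ℝ = 0 := fun i j hij hj =>
      ih j (by omega) (fun k hk => h k (by omega)) i hij
    have unit : ∀ i, i ≤ n → ⟪(minresState A g i).v, (minresState A g i).v⟫_ℝ = 1 := by
      intro i hi
      rw [real_inner_self_eq_norm_sq, minresState_norm_v (h i (by omega)), one_pow]
    intro i hi
    change ⟪_, ((minresState A g n).betaNext A)⁻¹ • (minresState A g n).q A⟫_ℝ = 0
    rw [inner_smul_right]
    refine mul_eq_zero_of_right _ ?_
    rw [MinresState.q, inner_sub_right, inner_sub_right, inner_smul_right, inner_smul_right]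
    rcases Nat.lt_or_ge i n with hin | hin
    · obtain ⟨m, rfl⟩ : ∃ m, n = m + 1 := ⟨n - 1, by omega⟩
      have hvp : (minresState A g (m + 1)).vPrev = (minresState A g m).v := rfl
      have hnext : ((minresState A g i).next A).v = (minresState A g (i + 1)).v := rfl
      rw [orth i (m + 1) hin le_rfl, mul_zero, sub_zero, hvp, ← hA, MinresState.apply_v, hnext,
        inner_add_left, inner_add_left, inner_smul_left, inner_smul_left, inner_smul_left,
        orth i (m + 1) hin le_rfl]
      have hp : ⟪(minresState A g i).vPrev, (minresState A g (m + 1)).v⟫_ℝ = 0 := by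
        cases i with
        | zero => exact inner_zero_left _
        | succ i => exact orth i (m + 1) (by omega) le_rfl
      rw [hp]
      rcases Nat.lt_or_ge i m with him | him
      · rw [orth (i + 1) (m + 1) (by omega) le_rfl, orth i m him (by omega)]
        simp
      · obtain rfl : i = m := by omega
        rw [unit (i + 1) le_rfl, unit i (by omega)]
        change (minresState A g i).betaNext A * 1 + _ * 0 + _ * 0
          - (minresState A g i).betaNext A * 1 = 0
        ring
    · obtain rfl : i = n := by omega
      have hp : ⟪(minresState A g i).v, (minresState A g i).vPrev⟫_ℝ = 0 := by
        cases i with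
        | zero => exact inner_zero_right _
        | succ i => rw [real_inner_comm]; exact orth i (i + 1) (by omega) le_rfl
      rw [hp, unit i le_rfl, MinresState.alpha]
      ring

/-- The span of the first `n` Lanczos vectors. -/
noncomputable def lanczosSpan (A : Vec d →L[ℝ] Vec d) (g : Vec d) (n : ℕ) :
    Submodule ℝ (Vec d) :=
  Submodule.span ℝ ((fun j => (minresState A g j).v) '' Set.Iio n)

theorem lanczosSpan_mono {m n : ℕ} (h : m ≤ n) : lanczosSpan A g m ≤ lanczosSpan A g n :=
  Submodule.span_mono (Set.image_mono (Set.Iio_subset_Iio h))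

theorem v_mem_lanczosSpan {j n : ℕ} (h : j < n) : (minresState A g j).v ∈ lanczosSpan A g n :=
  Submodule.subset_span ⟨j, h, rfl⟩

theorem lanczosSpan_induction {n : ℕ} {p : Vec d → Prop}
    (hv : ∀ j < n, p (minresState A g j).v) (h0 : p 0) (hadd : ∀ x y, p x → p y → p (x + y))
    (hsmul : ∀ (a : ℝ) x, p x → p (a • x)) : ∀ x ∈ lanczosSpan A g n, p x := by
  intro x hx
  induction hx using Submodule.span_induction with
  | mem x hx => obtain ⟨j, hj, rfl⟩ := hx; exact hv j hj
  | zero => exact h0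
  | add x y _ _ hx hy => exact hadd x y hx hy
  | smul a x _ hx => exact hsmul a x hx

theorem apply_mem_lanczosSpan {n : ℕ} :
    ∀ x ∈ lanczosSpan A g n, A x ∈ lanczosSpan A g (n + 1) := by
  refine lanczosSpan_induction (fun j hj => ?_) (by simp)
    (fun x y hx hy => by rw [map_add]; exact add_mem hx hy)
    (fun a x hx => by rw [map_smul]; exact Submodule.smul_mem _ _ hx)
  rw [MinresState.apply_v]
  refine add_mem (add_mem (Submodule.smul_mem _ _ ?_) (Submodule.smul_mem _ _ ?_))
    (Submodule.smul_mem _ _ ?_)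
  · exact v_mem_lanczosSpan (j := j + 1) (by omega)
  · exact v_mem_lanczosSpan (by omega)
  · cases j with
    | zero => exact zero_mem _
    | succ j => exact v_mem_lanczosSpan (by omega)

theorem inner_v_of_mem_lanczosSpan (hA : ∀ x y : Vec d, ⟪A x, y⟫_ℝ = ⟪x, A y⟫_ℝ) {n : ℕ}
    (h : ∀ j < n, (minresState A g j).beta ≠ 0) :
    ∀ x ∈ lanczosSpan A g n, ⟪x, (minresState A g n).v⟫_ℝ = 0 :=
  lanczosSpan_induction (minresState_inner_v hA h) (inner_zero_left _)
    (fun x y hx hy => by rw [inner_add_left, hx, hy, add_zero])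
    (fun a x hx => by rw [inner_smul_left, hx, mul_zero])

/-! ### Algebra of the reflections -/

/-- The algebraic relations between the variables of MINRES. The vector `uPrev` is the direction
of the preceding residual, and `s uPrev - c v` is that of the current one. -/
structure MinresState.Relations (A : Vec d →L[ℝ] Vec d) (g : Vec d) (S : MinresState d)
    (uPrev : Vec d) : Prop where
  apply_w : A S.w = S.c • uPrev + S.s • S.v
  delta_smul : S.delta • uPrev = S.beta • S.vPrev - S.eps • A S.wPrev
  apply_uPrev : S.s • A uPrev = (S.c * S.beta) • S.vPrev + (S.s * S.delta) • S.v
  s_smul : S.s • uPrev = S.delta • S.w + (S.c * S.eps) • S.wPrev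
  sq_add_sq : S.c ^ 2 + S.s ^ 2 = 1
  s_nonneg : 0 ≤ S.s
  phi_nonneg : 0 ≤ S.phi
  res_eq_smul : S.res = S.phi • (S.s • uPrev - S.c • S.v)
  res_eq : S.res = -g - A S.iter

namespace MinresState.Relations

variable {S : MinresState d} {uPrev : Vec d}

theorem start : (MinresState.start g).Relations A g 0 where
  apply_w := by simp [MinresState.start]
  delta_smul := by simp [MinresState.start]
  apply_uPrev := by simp [MinresState.start]
  s_smul := by simp [MinresState.start]
  sq_add_sq := by simp [MinresState.start]
  s_nonneg := by simp [MinresState.start]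
  phi_nonneg := by simp [MinresState.start]
  res_eq_smul := by
    by_cases h : g = 0
    · simp [MinresState.start, h]
    · simp [MinresState.start, smul_smul, h]
  res_eq := by simp [MinresState.start]

/-- The direction of the residual is a combination of the last two directions `w`. -/
theorem direction_eq (R : S.Relations A g uPrev) (hγ : S.gamma2 A ≠ 0) :
    S.s • uPrev - S.c • S.v
      = (-(S.c * S.gamma2 A)) • (S.next A).w + (S.s * S.gamma1 A) • S.w := by
  have hw : (S.next A).w = (S.gamma2 A)⁻¹ • (S.v - S.delta2 A • S.w - S.eps • S.wPrev) := by
    simp [MinresState.next, hγ]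
  rw [hw, R.s_smul, smul_smul, neg_mul, mul_assoc, mul_inv_cancel₀ hγ, mul_one]
  -- The reflection with rows (c, s) and (s, -c) is its own inverse; applied to (`delta2`, `gamma1`)
  -- it returns `delta`.
  have h : S.delta = S.c * S.delta2 A + S.s * S.gamma1 A := by
    rw [MinresState.delta2, MinresState.gamma1]
    linear_combination (-S.delta) * R.sq_add_sq
  nth_rewrite 1 [h]
  module

/-- The two multiples of `vPrev` cancel. The remaining coefficients are those in the scalar tests
for ‖A r‖ and ⟨r, A r⟩. -/
theorem apply_direction (R : S.Relations A g uPrev) :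
    A (S.s • uPrev - S.c • S.v) = S.gamma1 A • S.v + S.deltaNext A • (S.next A).v := by
  rw [map_sub, map_smul, map_smul, R.apply_uPrev, MinresState.apply_v, MinresState.gamma1,
    MinresState.deltaNext]
  module

theorem v_eq (hγ : S.gamma2 A ≠ 0) :
    S.v = S.gamma2 A • (S.next A).w + S.delta2 A • S.w + S.eps • S.wPrev := by
  have hw : (S.next A).w = (S.gamma2 A)⁻¹ • (S.v - S.delta2 A • S.w - S.eps • S.wPrev) := by
    simp [MinresState.next, hγ]
  rw [hw, smul_inv_smul₀ hγ]
  abel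

/-- In `key`, expanding `A` on the new `w` cancels `vPrev` and leaves the current residual direction
and the new Lanczos vector; dividing by `gamma2` turns their coefficients into the new `c` and `s`.
The other relations follow by algebra with c² + s² = 1. -/
theorem next (R : S.Relations A g uPrev) (hγ : S.gamma2 A ≠ 0) :
    (S.next A).Relations A g (S.s • uPrev - S.c • S.v) := by
  have hγ2 : S.gamma2 A ^ 2 = S.gamma1 A ^ 2 + S.betaNext A ^ 2 :=
    Real.sq_sqrt (by positivity)
  have hγ0 : 0 ≤ S.gamma2 A := Real.sqrt_nonneg _
  have hβ0 : 0 ≤ S.betaNext A := norm_nonneg _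
  have hc : (S.next A).c = S.gamma1 A / S.gamma2 A := by simp [MinresState.next, hγ]
  have hs : (S.next A).s = S.betaNext A / S.gamma2 A := by simp [MinresState.next, hγ]
  have hphi : (S.next A).phi = (S.next A).s * S.phi := by simp [MinresState.next, hγ]
  have hit : (S.next A).iter = S.iter + ((S.next A).c * S.phi) • (S.next A).w := by
    simp [MinresState.next, hγ]
  have hres : (S.next A).res
      = (S.next A).s ^ 2 • S.res - ((S.next A).phi * (S.next A).c) • (S.next A).v := by
    simp [MinresState.next, hγ]
  have hβ : (S.next A).beta = S.betaNext A := rfl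
  have hδ : (S.next A).delta = -S.c * S.betaNext A := rfl
  have hε : (S.next A).eps = S.s * S.betaNext A := rfl
  have hvp : (S.next A).vPrev = S.v := rfl
  have hwp : (S.next A).wPrev = S.w := rfl
  have hcγ : (S.next A).c * S.gamma2 A = S.gamma1 A := by rw [hc]; field_simp
  have hsγ : (S.next A).s * S.gamma2 A = S.betaNext A := by rw [hs]; field_simp
  have hsq : (S.next A).c ^ 2 + (S.next A).s ^ 2 = 1 := by
    rw [hc, hs]; field_simp; linarith
  have key : S.gamma2 A • A (S.next A).w
      = S.gamma1 A • (S.s • uPrev - S.c • S.v) + S.betaNext A • (S.next A).v := by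
    have h1 : S.gamma2 A • (S.next A).w = S.v - S.delta2 A • S.w - S.eps • S.wPrev := by
      have := v_eq (A := A) hγ
      rw [sub_sub, eq_sub_iff_add_eq, ← add_assoc]
      exact this.symm
    rw [← map_smul, h1, map_sub, map_sub, map_smul, map_smul, MinresState.apply_v (A := A) S]
    have h2 : S.eps • A S.wPrev = S.beta • S.vPrev - S.delta • uPrev := by
      rw [R.delta_smul]; abel
    rw [h2, R.apply_w, MinresState.delta2, MinresState.gamma1]
    match_scalars
    · ring
    · linear_combination (-(S.alpha A)) * R.sq_add_sq
    · ring
    · linear_combination (-(S.delta)) * R.sq_add_sq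
  have happly : A (S.next A).w
      = (S.next A).c • (S.s • uPrev - S.c • S.v) + (S.next A).s • (S.next A).v := by
    have : A (S.next A).w = (S.gamma2 A)⁻¹ • (S.gamma2 A • A (S.next A).w) :=
      (inv_smul_smul₀ hγ _).symm
    rw [this, key, hc, hs, smul_add, smul_smul, smul_smul]
    congr 2 <;> ring
  refine ⟨happly, ?_, ?_, ?_, hsq, ?_, ?_, ?_, ?_⟩
  · rw [hδ, hβ, hε, hvp, hwp, R.apply_w]
    match_scalars
    · ring
    · linear_combination S.betaNext A * R.sq_add_sq
  · rw [R.apply_direction, hβ, hvp, hδ, MinresState.deltaNext, ← hcγ, ← hsγ]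
    module
  · rw [R.direction_eq hγ, hδ, hε, hwp, ← hcγ, ← hsγ]
    module
  · rw [hs]; positivity
  · rw [hphi, hs]
    have := R.phi_nonneg
    positivity
  · rw [hres, hphi, R.res_eq_smul]
    module
  -- The residual recurrence agrees with the effect of the iterate's update, because s² = 1 - c² for
  -- the new coefficients.
  · have h1 : (S.next A).res = S.res - ((S.next A).c * S.phi) • A (S.next A).w := by
      rw [hres, happly, hphi]
      nth_rewrite 2 [R.res_eq_smul]
      rw [R.res_eq_smul]
      have h3 : (S.next A).s ^ 2 = 1 - (S.next A).c ^ 2 := by linarith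
      rw [h3]
      module
    rw [h1, R.res_eq, hit, map_add, map_smul]
    abel

end MinresState.Relations

/-! ### Orthogonality and signs along the MINRES run -/

/-- The relations of MINRES at the beginning of iteration `n + 1`, with their orthogonality and
sign properties. -/
structure MinresInvariant (A : Vec d →L[ℝ] Vec d) (g : Vec d) (n : ℕ) (uPrev : Vec d) : Prop
    extends (minresState A g n).Relations A g uPrev where
  uPrev_mem : uPrev ∈ lanczosSpan A g n
  w_mem : (minresState A g n).w ∈ lanczosSpan A g n
  wPrev_mem : (minresState A g n).wPrev ∈ lanczosSpan A g n
  iter_mem : (minresState A g n).iter ∈ lanczosSpan A g n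
  orth : ∀ x ∈ lanczosSpan A g n,
    ⟪(minresState A g n).s • uPrev - (minresState A g n).c • (minresState A g n).v, A x⟫_ℝ = 0
  norm_eq_one : (minresState A g n).beta ≠ 0 →
    ‖(minresState A g n).s • uPrev - (minresState A g n).c • (minresState A g n).v‖ = 1
  phi_eq_zero : (minresState A g n).beta = 0 → (minresState A g n).phi = 0
  inner_w : 0 ≤ (minresState A g n).c * ⟪uPrev, (minresState A g n).w⟫_ℝ
  inner_iter : 0 ≤ ⟪(minresState A g n).iter,
    (minresState A g n).s • uPrev - (minresState A g n).c • (minresState A g n).v⟫_ℝ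

theorem beta_ne_zero_of_not_npcAt {n : ℕ} (h : ¬ NpcAt A g n) : (minresState A g n).beta ≠ 0 :=
  fun h0 => h (npcAt_of_beta_eq_zero h0)

/-- Nondetection says c γ⁽¹⁾ < 0, so γ⁽²⁾ > 0 and the new reflection exists. The new direction s u -
c v' is orthogonal to A w' = c u + s v' and, by induction, to the image of the old span; the new
span is generated by the old one and w'. -/
theorem MinresInvariant.next (hA : ∀ x y : Vec d, ⟪A x, y⟫_ℝ = ⟪x, A y⟫_ℝ) {n : ℕ}
    (h : ∀ j < n + 1, ¬ NpcAt A g j) {uPrev : Vec d} (I : MinresInvariant A g n uPrev) :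
    ∃ u, MinresInvariant A g (n + 1) u := by
  have hβ : ∀ j < n + 1, (minresState A g j).beta ≠ 0 :=
    fun j hj => beta_ne_zero_of_not_npcAt (h j hj)
  have hv := inner_v_of_mem_lanczosSpan hA (fun j hj => hβ j (Nat.lt_succ_of_lt hj))
  have hv' := inner_v_of_mem_lanczosSpan hA hβ
  have hneg : (minresState A g n).c * (minresState A g n).gamma1 A < 0 :=
    not_le.1 (h n n.lt_succ_self)
  have hSn : minresState A g (n + 1) = (minresState A g n).next A := rfl
  have hvn : (minresState A g n).v ∈ lanczosSpan A g (n + 1) := v_mem_lanczosSpan n.lt_succ_self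
  have hle : lanczosSpan A g n ≤ lanczosSpan A g (n + 1) := lanczosSpan_mono n.le_succ
  have hnorm := minresState_norm_v (A := A) (g := g) (n := n + 1)
  have hunit := I.norm_eq_one (hβ n n.lt_succ_self)
  rw [hSn] at hv' hnorm
  obtain ⟨R, hu, hwm, hwpm, him, horth, -, -, hcw, hciter⟩ := I
  set S := minresState A g n with hS
  have hc0 : S.c ≠ 0 := fun h0 => by simp [h0] at hneg
  have hγ1 : S.gamma1 A ≠ 0 := fun h0 => by simp [h0] at hneg
  have hγpos : 0 < S.gamma2 A := Real.sqrt_pos.2 (by positivity)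
  have hγ := hγpos.ne'
  have hc : (S.next A).c = S.gamma1 A / S.gamma2 A := by simp [MinresState.next, hγ]
  have hs : (S.next A).s = S.betaNext A / S.gamma2 A := by simp [MinresState.next, hγ]
  have hphi : (S.next A).phi = (S.next A).s * S.phi := by simp [MinresState.next, hγ]
  have hit : (S.next A).iter = S.iter + ((S.next A).c * S.phi) • (S.next A).w := by
    simp [MinresState.next, hγ]
  have hw' : (S.next A).w = (S.gamma2 A)⁻¹ • (S.v - S.delta2 A • S.w - S.eps • S.wPrev) := by
    simp [MinresState.next, hγ]
  have R' := R.next hγ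
  have hdir := R.direction_eq hγ
  have hveq := MinresState.Relations.v_eq (S := S) hγ
  set u := S.s • uPrev - S.c • S.v with hudef
  have hum : u ∈ lanczosSpan A g (n + 1) :=
    sub_mem (Submodule.smul_mem _ _ (hle hu)) (Submodule.smul_mem _ _ hvn)
  have hwm' : (S.next A).w ∈ lanczosSpan A g (n + 1) := by
    rw [hw']
    exact Submodule.smul_mem _ _ (sub_mem (sub_mem hvn (Submodule.smul_mem _ _ (hle hwm)))
      (Submodule.smul_mem _ _ (hle hwpm)))
  have huv : ⟪u, (S.next A).v⟫_ℝ = 0 := hv' u hum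
  -- If the Lanczos process ends here, the new `v` is zero, but so is the new `s`.
  have hvsq : (S.next A).s * ⟪(S.next A).v, (S.next A).v⟫_ℝ = (S.next A).s := by
    by_cases h0 : S.betaNext A = 0
    · rw [hs, h0]; simp
    · rw [real_inner_self_eq_norm_sq, hnorm h0]; ring
  have huu : ⟪u, u⟫_ℝ = 1 := by rw [real_inner_self_eq_norm_sq, hunit, one_pow]
  have hvu : ⟪(S.next A).v, u⟫_ℝ = 0 := by rw [real_inner_comm]; exact huv
  have horthw : ⟪(S.next A).s • u - (S.next A).c • (S.next A).v, A (S.next A).w⟫_ℝ = 0 := by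
    rw [R'.apply_w]
    simp only [inner_sub_left, inner_add_right, inner_smul_left, inner_smul_right, huv, hvu, huu,
      RCLike.conj_to_real]
    linear_combination (-(S.next A).c) * hvsq
  have horthn : ∀ x ∈ lanczosSpan A g n,
      ⟪(S.next A).s • u - (S.next A).c • (S.next A).v, A x⟫_ℝ = 0 := by
    intro x hx
    have h1 : ⟪(S.next A).v, A x⟫_ℝ = 0 := by
      rw [real_inner_comm]; exact hv' _ (apply_mem_lanczosSpan x hx)
    rw [inner_sub_left, inner_smul_left, inner_smul_left, horth x hx, h1]
    simp
  -- Pair the unit direction with its expansion in the last two `w` and multiply by c γ⁽¹⁾: the sign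
  -- follows from c γ⁽¹⁾ < 0 and the inductive sign `hcw`.
  have hγuw : 0 ≤ S.gamma1 A * ⟪u, (S.next A).w⟫_ℝ := by
    have h1 : ⟪u, u⟫_ℝ = -(S.c * S.gamma2 A) * ⟪u, (S.next A).w⟫_ℝ
        + S.s * S.gamma1 A * ⟪u, S.w⟫_ℝ := by
      nth_rewrite 2 [hdir]
      rw [inner_add_right, inner_smul_right, inner_smul_right]
    have h2 : ⟪u, S.w⟫_ℝ = S.s * ⟪uPrev, S.w⟫_ℝ := by
      have h3 : ⟪S.v, S.w⟫_ℝ = 0 := by rw [real_inner_comm]; exact hv _ hwm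
      rw [hudef, inner_sub_left, inner_smul_left, inner_smul_left, h3]
      simp
    rw [huu, h2] at h1
    have h3 : S.c ^ 2 * (S.gamma2 A * (S.gamma1 A * ⟪u, (S.next A).w⟫_ℝ))
        = -(S.c * S.gamma1 A) + (S.s * S.gamma1 A) ^ 2 * (S.c * ⟪uPrev, S.w⟫_ℝ) := by
      linear_combination (S.c * S.gamma1 A) * h1
    have h4 : 0 ≤ S.c ^ 2 * (S.gamma2 A * (S.gamma1 A * ⟪u, (S.next A).w⟫_ℝ)) := by
      rw [h3]
      have := mul_nonneg (sq_nonneg (S.s * S.gamma1 A)) hcw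
      linarith
    exact nonneg_of_mul_nonneg_right (nonneg_of_mul_nonneg_right h4 (by positivity)) hγpos
  have hcuw : 0 ≤ (S.next A).c * ⟪u, (S.next A).w⟫_ℝ := by
    rw [hc, div_mul_eq_mul_div]
    exact div_nonneg hγuw hγpos.le
  have himem : (S.next A).iter ∈ lanczosSpan A g (n + 1) := by
    rw [hit]
    exact add_mem (hle him) (Submodule.smul_mem _ _ hwm')
  refine ⟨u, R', hum, hwm', hle hwm, himem, ?_, ?_, ?_, hcuw, ?_⟩
  · refine lanczosSpan_induction (fun j hj => ?_) (by simp)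
      (fun x y hx hy => by rw [map_add, inner_add_right, hx, hy, add_zero])
      (fun a x hx => by rw [map_smul, inner_smul_right, hx, mul_zero])
    rcases Nat.lt_or_ge j n with hjn | hjn
    · exact horthn _ (v_mem_lanczosSpan hjn)
    · obtain rfl : j = n := by omega
      rw [← hS, hveq, hSn]
      simp only [map_add, map_smul, inner_add_right, inner_smul_right, horthw, horthn _ hwm,
        horthn _ hwpm]
      ring
  · intro h0
    have h1 := hnorm h0
    have h2 : ⟪(S.next A).v, (S.next A).v⟫_ℝ = 1 := by
      rw [real_inner_self_eq_norm_sq, h1, one_pow]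
    have h3 : ‖(S.next A).s • u - (S.next A).c • (S.next A).v‖ ^ 2 = 1 := by
      rw [← real_inner_self_eq_norm_sq]
      simp only [inner_sub_left, inner_sub_right, inner_smul_left, inner_smul_right, huv, hvu, huu,
        h2, RCLike.conj_to_real]
      linear_combination R'.sq_add_sq
    exact (pow_eq_one_iff_of_nonneg (norm_nonneg _) two_ne_zero).1 h3
  · intro h0
    have h1 : S.betaNext A = 0 := h0
    rw [hSn, hphi, hs, h1, zero_div, zero_mul]
  -- The new Lanczos vector is orthogonal to the iterate, so only s⟨iter, u⟩ remains; the update of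
  -- the iterate contributes with the sign of `hcuw`.
  · rw [hSn, inner_sub_right, inner_smul_right, inner_smul_right, hv' _ himem, hit, inner_add_left,
      inner_smul_left, real_inner_comm u (S.next A).w, mul_zero, sub_zero]
    refine mul_nonneg R'.s_nonneg (add_nonneg hciter ?_)
    rw [RCLike.conj_to_real, mul_right_comm]
    exact mul_nonneg hcuw R.phi_nonneg

theorem exists_minresInvariant (hA : ∀ x y : Vec d, ⟪A x, y⟫_ℝ = ⟪x, A y⟫_ℝ) {n : ℕ}
    (h : ∀ j < n, ¬ NpcAt A g j) : ∃ u, MinresInvariant A g n u := by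
  induction n with
  | zero =>
    refine ⟨0, MinresState.Relations.start, zero_mem _, zero_mem _, zero_mem _, zero_mem _,
      ?_, ?_, ?_, ?_, ?_⟩
    · refine lanczosSpan_induction (fun j hj => absurd hj j.not_lt_zero) (by simp)
        (fun x y hx hy => by rw [map_add, inner_add_right, hx, hy, add_zero])
        (fun a x hx => by rw [map_smul, inner_smul_right, hx, mul_zero])
    · intro h0
      have := minresState_norm_v h0
      simpa [minresState, MinresState.start, norm_smul] using this
    -- Initially `beta` and `phi` are both ‖g‖.
    · exact fun h0 => h0
    · simp [minresState, MinresState.start]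
    · simp [minresState, MinresState.start]
  | succ n ih =>
    obtain ⟨u, I⟩ := ih (fun j hj => h j (Nat.lt_succ_of_lt hj))
    exact I.next hA h

/-! ### Residual minimality, tests and descent properties -/

section Consequences

variable {n : ℕ}

theorem minres_res_eq (hA : ∀ x y : Vec d, ⟪A x, y⟫_ℝ = ⟪x, A y⟫_ℝ)
    (h : ∀ j < n, ¬ NpcAt A g j) :
    (minresState A g n).res = -g - A (minresState A g n).iter :=
  let ⟨_, I⟩ := exists_minresInvariant hA h
  I.res_eq

theorem minres_norm_res (hA : ∀ x y : Vec d, ⟪A x, y⟫_ℝ = ⟪x, A y⟫_ℝ)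
    (h : ∀ j < n, ¬ NpcAt A g j) : ‖(minresState A g n).res‖ = (minresState A g n).phi := by
  obtain ⟨u, I⟩ := exists_minresInvariant hA h
  rw [I.res_eq_smul, norm_smul, Real.norm_of_nonneg I.phi_nonneg]
  by_cases h0 : (minresState A g n).beta = 0
  · rw [I.phi_eq_zero h0, zero_mul]
  · rw [I.norm_eq_one h0, mul_one]

theorem minres_iter_mem (hA : ∀ x y : Vec d, ⟪A x, y⟫_ℝ = ⟪x, A y⟫_ℝ)
    (h : ∀ j < n, ¬ NpcAt A g j) : (minresState A g n).iter ∈ lanczosSpan A g n :=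
  let ⟨_, I⟩ := exists_minresInvariant hA h
  I.iter_mem

theorem minres_res_mem (hA : ∀ x y : Vec d, ⟪A x, y⟫_ℝ = ⟪x, A y⟫_ℝ)
    (h : ∀ j < n, ¬ NpcAt A g j) : (minresState A g n).res ∈ lanczosSpan A g (n + 1) := by
  obtain ⟨u, I⟩ := exists_minresInvariant hA h
  rw [I.res_eq_smul]
  exact Submodule.smul_mem _ _ (sub_mem
    (Submodule.smul_mem _ _ (lanczosSpan_mono n.le_succ I.uPrev_mem))
    (Submodule.smul_mem _ _ (v_mem_lanczosSpan n.lt_succ_self)))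

/-- These are the normal equations of residual minimization. The Pythagorean splitting of g, the
slope along the residual and minimality all come from them. -/
theorem minres_inner_res_apply (hA : ∀ x y : Vec d, ⟪A x, y⟫_ℝ = ⟪x, A y⟫_ℝ)
    (h : ∀ j < n, ¬ NpcAt A g j) :
    ∀ x ∈ lanczosSpan A g n, ⟪(minresState A g n).res, A x⟫_ℝ = 0 := by
  obtain ⟨u, I⟩ := exists_minresInvariant hA h
  intro x hx
  rw [I.res_eq_smul, inner_smul_left, I.orth x hx, mul_zero]

theorem minres_inner_iter_res (hA : ∀ x y : Vec d, ⟪A x, y⟫_ℝ = ⟪x, A y⟫_ℝ)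
    (h : ∀ j < n, ¬ NpcAt A g j) :
    0 ≤ ⟪(minresState A g n).iter, (minresState A g n).res⟫_ℝ := by
  obtain ⟨u, I⟩ := exists_minresInvariant hA h
  rw [I.res_eq_smul, inner_smul_right]
  exact mul_nonneg I.phi_nonneg I.inner_iter

theorem minres_norm_apply_iter_sq (hA : ∀ x y : Vec d, ⟪A x, y⟫_ℝ = ⟪x, A y⟫_ℝ)
    (h : ∀ j < n, ¬ NpcAt A g j) :
    ‖A (minresState A g n).iter‖ ^ 2 = ‖g‖ ^ 2 - (minresState A g n).phi ^ 2 := by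
  have h1 := minres_inner_res_apply hA h _ (minres_iter_mem hA h)
  have h2 : -g = (minresState A g n).res + A (minresState A g n).iter := by
    rw [minres_res_eq hA h]; abel
  rw [← norm_neg g, h2, norm_add_sq_real, h1, ← minres_norm_res hA h]
  ring

theorem minres_norm_apply_res (hA : ∀ x y : Vec d, ⟪A x, y⟫_ℝ = ⟪x, A y⟫_ℝ)
    (h : ∀ j < n, ¬ NpcAt A g j) :
    ‖A (minresState A g n).res‖ = (minresState A g n).phi *
      √((minresState A g n).gamma1 A ^ 2 + (minresState A g n).deltaNext A ^ 2) := by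
  obtain ⟨u, I⟩ := exists_minresInvariant hA h
  rw [I.res_eq_smul, map_smul, norm_smul, Real.norm_of_nonneg I.phi_nonneg]
  by_cases h0 : (minresState A g n).beta = 0
  · rw [I.phi_eq_zero h0, zero_mul, zero_mul]
  congr 1
  symm
  rw [Real.sqrt_eq_iff_mul_self_eq (by positivity) (norm_nonneg _), I.apply_direction, ← sq,
    norm_add_sq_real, norm_smul, norm_smul, minresState_norm_v h0]
  have hβ : ∀ j < n + 1, (minresState A g j).beta ≠ 0 := by
    intro j hj
    rcases Nat.lt_or_ge j n with hjn | hjn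
    · exact beta_ne_zero_of_not_npcAt (h j hjn)
    · obtain rfl : j = n := by omega
      exact h0
  have h1 : ⟪(minresState A g n).v, ((minresState A g n).next A).v⟫_ℝ = 0 :=
    minresState_inner_v hA hβ n n.lt_succ_self
  -- The new Lanczos vector is a unit vector or zero; in the latter case `deltaNext` vanishes with
  -- `betaNext`.
  have h2 : (‖(minresState A g n).deltaNext A‖ * ‖((minresState A g n).next A).v‖) ^ 2
      = (minresState A g n).deltaNext A ^ 2 := by
    by_cases h3 : (minresState A g (n + 1)).beta = 0
    · have h4 : (minresState A g n).betaNext A = 0 := h3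
      simp [MinresState.deltaNext, h4]
    · have h4 : ‖((minresState A g n).next A).v‖ = 1 := minresState_norm_v (n := n + 1) h3
      rw [h4, mul_one, Real.norm_eq_abs, sq_abs]
  rw [h2, inner_smul_left, inner_smul_right, h1, mul_one, Real.norm_eq_abs, sq_abs]
  simp

/-- The scalar inexactness test is the inexactness condition. -/
theorem solAt_iff (hA : ∀ x y : Vec d, ⟪A x, y⟫_ℝ = ⟪x, A y⟫_ℝ)
    (h : ∀ j < n, ¬ NpcAt A g j) {η : ℝ} :
    SolAt A g η n ↔
      ‖A (minresState A g n).res‖ < η * ‖A (minresState A g n).iter‖ := by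
  rw [SolAt, MinresState.SolTest, ← minres_norm_apply_res hA h,
    ← minres_norm_apply_iter_sq hA h, Real.sqrt_sq (norm_nonneg _)]

/-- The scalar curvature test detects nonpositive curvature of the residual. -/
theorem inner_res_apply_res_nonpos (hA : ∀ x y : Vec d, ⟪A x, y⟫_ℝ = ⟪x, A y⟫_ℝ)
    (h : ∀ j < n, ¬ NpcAt A g j) (hn : NpcAt A g n) :
    ⟪(minresState A g n).res, A (minresState A g n).res⟫_ℝ ≤ 0 := by
  obtain ⟨u, I⟩ := exists_minresInvariant hA h
  by_cases h0 : (minresState A g n).beta = 0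
  · simp [I.res_eq_smul, I.phi_eq_zero h0]
  have hβ : ∀ j < n + 1, (minresState A g j).beta ≠ 0 := by
    intro j hj
    rcases Nat.lt_or_ge j n with hjn | hjn
    · exact beta_ne_zero_of_not_npcAt (h j hjn)
    · obtain rfl : j = n := by omega
      exact h0
  have hum : (minresState A g n).s • u - (minresState A g n).c • (minresState A g n).v
      ∈ lanczosSpan A g (n + 1) := sub_mem
    (Submodule.smul_mem _ _ (lanczosSpan_mono n.le_succ I.uPrev_mem))
    (Submodule.smul_mem _ _ (v_mem_lanczosSpan n.lt_succ_self))
  have h1 : ⟪(minresState A g n).s • u - (minresState A g n).c • (minresState A g n).v,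
      ((minresState A g n).next A).v⟫_ℝ = 0 := inner_v_of_mem_lanczosSpan hA hβ _ hum
  have h2 : ⟪(minresState A g n).s • u - (minresState A g n).c • (minresState A g n).v,
      (minresState A g n).v⟫_ℝ = -(minresState A g n).c := by
    rw [inner_sub_left, inner_smul_left, inner_smul_left, real_inner_self_eq_norm_sq,
      minresState_norm_v h0,
      inner_v_of_mem_lanczosSpan hA (fun j hj => hβ j (Nat.lt_succ_of_lt hj)) _ I.uPrev_mem]
    simp
  have h3 : 0 ≤ (minresState A g n).c * (minresState A g n).gamma1 A := hn
  rw [I.res_eq_smul, map_smul, inner_smul_left, inner_smul_right, I.apply_direction,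
    inner_add_right, inner_smul_right, inner_smul_right, h1, h2, RCLike.conj_to_real]
  have := mul_nonneg (mul_self_nonneg (minresState A g n).phi) h3
  linarith

theorem minres_inner_res (hA : ∀ x y : Vec d, ⟪A x, y⟫_ℝ = ⟪x, A y⟫_ℝ)
    (h : ∀ j < n, ¬ NpcAt A g j) :
    ⟪g, (minresState A g n).res⟫_ℝ = -‖(minresState A g n).res‖ ^ 2 := by
  have h1 := minres_inner_res_apply hA h _ (minres_iter_mem hA h)
  have h2 : g = -(minresState A g n).res - A (minresState A g n).iter := by
    rw [minres_res_eq hA h]; abel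
  nth_rewrite 1 [h2]
  rw [inner_sub_left, inner_neg_left, real_inner_self_eq_norm_sq, real_inner_comm, h1, sub_zero]

/-- Split g = -r - A s and discard ⟨s, r⟩ ≥ 0. Where A has curvature at least σ, this makes s a
descent direction. -/
theorem minres_inner_iter (hA : ∀ x y : Vec d, ⟪A x, y⟫_ℝ = ⟪x, A y⟫_ℝ)
    (h : ∀ j < n, ¬ NpcAt A g j) :
    ⟪g, (minresState A g n).iter⟫_ℝ
      ≤ -⟪(minresState A g n).iter, A (minresState A g n).iter⟫_ℝ := by
  have h1 := minres_inner_iter_res hA h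
  have h2 : g = -(minresState A g n).res - A (minresState A g n).iter := by
    rw [minres_res_eq hA h]; abel
  nth_rewrite 1 [h2]
  rw [inner_sub_left, inner_neg_left, real_inner_comm, real_inner_comm _ (A _)]
  linarith

/-- The residuals of MINRES are minimal, so that a steepest-descent step bounds their decrease. -/
theorem minres_norm_res_succ_le (hA : ∀ x y : Vec d, ⟪A x, y⟫_ℝ = ⟪x, A y⟫_ℝ)
    (h : ∀ j < n + 1, ¬ NpcAt A g j) (a : ℝ) :
    ‖(minresState A g (n + 1)).res‖
      ≤ ‖(minresState A g n).res - a • A (minresState A g n).res‖ := by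
  have hn : ∀ j < n, ¬ NpcAt A g j := fun j hj => h j (Nat.lt_succ_of_lt hj)
  -- The competitor s_n + a r_n lies in the same Krylov space as s_{n+1}; the normal equations then
  -- give Pythagoras for the two residuals.
  have hmem : (minresState A g (n + 1)).iter - (minresState A g n).iter
      - a • (minresState A g n).res ∈ lanczosSpan A g (n + 1) :=
    sub_mem (sub_mem (minres_iter_mem hA h)
      (lanczosSpan_mono n.le_succ (minres_iter_mem hA hn)))
      (Submodule.smul_mem _ _ (minres_res_mem hA hn))
  have h1 := minres_inner_res_apply hA h _ hmem
  have h2 : (minresState A g n).res - a • A (minresState A g n).res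
      = (minresState A g (n + 1)).res + A ((minresState A g (n + 1)).iter
        - (minresState A g n).iter - a • (minresState A g n).res) := by
    rw [map_sub, map_sub, map_smul, minres_res_eq hA h]
    nth_rewrite 1 [minres_res_eq hA hn]
    abel
  rw [h2]
  refine le_of_sq_le_sq ?_ (norm_nonneg _)
  rw [norm_add_sq_real, h1]
  nlinarith [sq_nonneg ‖A ((minresState A g (n + 1)).iter
        - (minresState A g n).iter - a • (minresState A g n).res)‖]

/-- Until detection the Lanczos vectors are orthonormal, so T_n represents the quadratic form of `A`
on their span in isometric coordinates. -/
theorem inner_apply_of_lanczosMatrix_posSemidef (hA : ∀ x y : Vec d, ⟪A x, y⟫_ℝ = ⟪x, A y⟫_ℝ)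
    (h : ∀ j < n, ¬ NpcAt A g j) {σ : ℝ}
    (hT : (lanczosMatrix A g n - σ • (1 : Matrix (Fin n) (Fin n) ℝ)).PosSemidef) :
    ∀ x ∈ lanczosSpan A g n, σ * ‖x‖ ^ 2 ≤ ⟪x, A x⟫_ℝ := by
  have hβ : ∀ j < n, (minresState A g j).beta ≠ 0 :=
    fun j hj => beta_ne_zero_of_not_npcAt (h j hj)
  have horth : Orthonormal ℝ fun i : Fin n => (minresState A g i).v := by
    refine ⟨fun i => minresState_norm_v (hβ i i.2), fun i j hij => ?_⟩
    change ⟪_, _⟫_ℝ = 0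
    rcases lt_or_gt_of_ne hij with hlt | hlt
    · exact minresState_inner_v hA (fun k hk => hβ k (hk.trans j.2)) i hlt
    · rw [real_inner_comm]
      exact minresState_inner_v hA (fun k hk => hβ k (hk.trans i.2)) j hlt
  intro x hx
  have hspan : lanczosSpan A g n
      = Submodule.span ℝ (Set.range fun i : Fin n => (minresState A g i).v) := by
    rw [lanczosSpan]
    congr 1
    ext y
    constructor
    · rintro ⟨j, hj, rfl⟩; exact ⟨⟨j, hj⟩, rfl⟩
    · rintro ⟨j, rfl⟩; exact ⟨j, j.2, rfl⟩
  rw [hspan, Submodule.mem_span_range_iff_exists_fun] at hx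
  obtain ⟨a, rfl⟩ := hx
  have h1 := hT.dotProduct_mulVec_nonneg a
  have h2 : ‖∑ i, a i • (minresState A g i).v‖ ^ 2 = ∑ i, a i * a i := by
    rw [← real_inner_self_eq_norm_sq, horth.inner_sum]
    simp
  have h3 : ⟪∑ i, a i • (minresState A g i).v, A (∑ i, a i • (minresState A g i).v)⟫_ℝ
      = ∑ i, a i * ∑ j, lanczosMatrix A g n i j * a j := by
    rw [map_sum, sum_inner]
    refine Finset.sum_congr rfl fun i _ => ?_
    rw [inner_sum, Finset.mul_sum]
    refine Finset.sum_congr rfl fun j _ => ?_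
    rw [map_smul, inner_smul_left, inner_smul_right, lanczosMatrix, Matrix.of_apply,
      RCLike.conj_to_real]
    ring
  rw [Matrix.sub_mulVec, Matrix.smul_mulVec, Matrix.one_mulVec, dotProduct_sub,
    dotProduct_smul] at h1
  have h4 : star a ⬝ᵥ (lanczosMatrix A g n).mulVec a
      = ∑ i, a i * ∑ j, lanczosMatrix A g n i j * a j := rfl
  have h5 : star a ⬝ᵥ a = ∑ i, a i * a i := rfl
  rw [h4, h5, smul_eq_mul] at h1
  rw [h2, h3]
  linarith

end Consequences

end Minres

/-! ### Taylor bounds from a Lipschitz Hessian -/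

section Calculus

variable {d : ℕ} {f : Vec d → ℝ}

theorem inner_gradient (f : Vec d → ℝ) (x v : Vec d) : ⟪gradient f x, v⟫_ℝ = fderiv ℝ f x v :=
  InnerProductSpace.toDual_symm_apply

/-- The Riesz representation of the dual space, as a continuous linear map. -/
noncomputable def rieszVec (d : ℕ) : (Vec d →L[ℝ] ℝ) →L[ℝ] Vec d where
  toFun l := (InnerProductSpace.toDual ℝ (Vec d)).symm l
  map_add' l m := map_add _ l m
  map_smul' a l := by simp
  cont := (InnerProductSpace.toDual ℝ (Vec d)).symm.continuous

theorem hasFDerivAt_gradient (hf : ContDiff ℝ 2 f) (x : Vec d) :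
    HasFDerivAt (gradient f) (hess f x) x := by
  have h1 : DifferentiableAt ℝ (fderiv ℝ f) x :=
    (hf.fderiv_right (m := 1) (by norm_num)).differentiable (by norm_num) x
  have h2 : HasFDerivAt (gradient f) ((rieszVec d).comp (fderiv ℝ (fderiv ℝ f) x)) x :=
    (rieszVec d).hasFDerivAt.comp x h1.hasFDerivAt
  exact h2.differentiableAt.hasFDerivAt

theorem inner_hess (hf : ContDiff ℝ 2 f) (x v w : Vec d) :
    ⟪hess f x v, w⟫_ℝ = fderiv ℝ (fderiv ℝ f) x v w := by
  have h1 : DifferentiableAt ℝ (fderiv ℝ f) x :=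
    (hf.fderiv_right (m := 1) (by norm_num)).differentiable (by norm_num) x
  have h2 : HasFDerivAt (gradient f) ((rieszVec d).comp (fderiv ℝ (fderiv ℝ f) x)) x :=
    (rieszVec d).hasFDerivAt.comp x h1.hasFDerivAt
  rw [hess, h2.fderiv]
  exact InnerProductSpace.toDual_symm_apply

theorem hess_symm (hf : ContDiff ℝ 2 f) (x v w : Vec d) :
    ⟪hess f x v, w⟫_ℝ = ⟪v, hess f x w⟫_ℝ := by
  have h := hf.contDiffAt.isSymmSndFDerivAt (x := x) (by simp)
  rw [inner_hess hf, real_inner_comm, inner_hess hf]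
  exact h v w

/-- Mean value inequality on the ball of radius ‖p‖ for the gradient minus its linear part. The
factor 1/2 of the integral form is given up, at the price of constants only. -/
theorem norm_gradient_sub_le (hf : ContDiff ℝ 2 f) {L : ℝ} (hL : 0 ≤ L)
    (hlip : HessianLipschitz f L) (x p : Vec d) :
    ‖gradient f (x + p) - gradient f x - hess f x p‖ ≤ L * ‖p‖ ^ 2 := by
  have h1 : ∀ y ∈ Metric.closedBall (0 : Vec d) ‖p‖, HasFDerivWithinAt
      (fun y => gradient f (x + y) - hess f x y) (hess f (x + y) - hess f x)
      (Metric.closedBall 0 ‖p‖) y := by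
    intro y _
    exact (((hasFDerivAt_comp_add_left x).2 (hasFDerivAt_gradient hf (x + y))).sub
      (hess f x).hasFDerivAt).hasFDerivWithinAt
  have h2 : ∀ y ∈ Metric.closedBall (0 : Vec d) ‖p‖, ‖hess f (x + y) - hess f x‖ ≤ L * ‖p‖ := by
    intro y hy
    refine (hlip _ _).trans ?_
    rw [add_sub_cancel_left]
    exact mul_le_mul_of_nonneg_left (mem_closedBall_zero_iff.1 hy) hL
  have h3 := Convex.norm_image_sub_le_of_norm_hasFDerivWithin_le h1 h2
    (convex_closedBall _ _) (Metric.mem_closedBall_self (norm_nonneg p))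
    (mem_closedBall_zero_iff.2 le_rfl)
  simp only [add_zero, map_zero, sub_zero] at h3
  calc _ = ‖gradient f (x + p) - hess f x p - gradient f x‖ := by congr 1; abel
    _ ≤ _ := h3
    _ = _ := by ring

/-- The same argument one order higher: the derivative of the remainder is the gradient error just
bounded. -/
theorem le_taylor_two (hf : ContDiff ℝ 2 f) {L : ℝ} (hL : 0 ≤ L)
    (hlip : HessianLipschitz f L) (x p : Vec d) :
    f (x + p) ≤ f x + ⟪gradient f x, p⟫_ℝ + 1 / 2 * ⟪p, hess f x p⟫_ℝ + L * ‖p‖ ^ 3 := by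
  have h1 : ∀ y ∈ Metric.closedBall (0 : Vec d) ‖p‖, HasFDerivWithinAt
      (fun y => f (x + y) - ⟪gradient f x, y⟫_ℝ - 1 / 2 * ⟪y, hess f x y⟫_ℝ)
      (innerSL ℝ (gradient f (x + y) - gradient f x - hess f x y))
      (Metric.closedBall 0 ‖p‖) y := by
    intro y _
    have e1 : HasFDerivAt (fun y => f (x + y)) (fderiv ℝ f (x + y)) y :=
      (hasFDerivAt_comp_add_left x).2 (hf.differentiable (by norm_num) (x + y)).hasFDerivAt
    have e2 : HasFDerivAt (fun y => ⟪gradient f x, y⟫_ℝ) (innerSL ℝ (gradient f x)) y :=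
      (innerSL ℝ (gradient f x)).hasFDerivAt
    have e3 := (((hasFDerivAt_id y).inner ℝ (hess f x).hasFDerivAt).const_mul (1 / 2 : ℝ))
    refine (((e1.sub e2).sub e3).congr_fderiv ?_).hasFDerivWithinAt
    ext v
    simp only [sub_apply, smul_apply, innerSL_apply_apply,
      inner_sub_left, inner_gradient, ContinuousLinearMap.comp_apply, fderivInnerCLM_apply,
      ContinuousLinearMap.prod_apply, id, ContinuousLinearMap.id_apply, smul_eq_mul]
    rw [← hess_symm hf x y v, real_inner_comm (hess f x y) v]
    ring
  have h2 : ∀ y ∈ Metric.closedBall (0 : Vec d) ‖p‖,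
      ‖innerSL ℝ (gradient f (x + y) - gradient f x - hess f x y)‖ ≤ L * ‖p‖ ^ 2 := by
    intro y hy
    rw [innerSL_apply_norm]
    refine (norm_gradient_sub_le hf hL hlip x y).trans ?_
    have := mem_closedBall_zero_iff.1 hy
    gcongr
  have h3 := Convex.norm_image_sub_le_of_norm_hasFDerivWithin_le h1 h2
    (convex_closedBall _ _) (Metric.mem_closedBall_self (norm_nonneg p))
    (mem_closedBall_zero_iff.2 le_rfl)
  simp only [add_zero, map_zero, sub_zero, inner_zero_right, mul_zero, Real.norm_eq_abs] at h3
  have h4 := (abs_le.1 h3).2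
  nlinarith [h4]

end Calculus

/-! ### Line searches: rejected neighbours and termination -/

section LineSearch

variable {d : ℕ} {f : Vec d → ℝ} {x p : Vec d} {ρ h α : ℝ}

/-- The rejected predecessor `β` is what later bounds the returned step from below. -/
theorem BackTracking.spec (hh : 0 < h) (hh' : h < 1) (H : BackTracking f x p ρ h α) :
    Armijo f x p ρ α ∧ 0 < α ∧ α ≤ 1 ∧
      (α = 1 ∨ ∃ β, 0 < β ∧ β ≤ 1 ∧ ¬ Armijo f x p ρ β ∧ α = h * β) := by
  obtain ⟨n, hn, ha, rfl⟩ := H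
  refine ⟨ha, by positivity, pow_le_one₀ hh.le hh'.le, ?_⟩
  cases n with
  | zero => left; simp
  | succ n =>
    exact Or.inr ⟨h ^ n, by positivity, pow_le_one₀ hh.le hh'.le, hn n n.lt_succ_self,
      pow_succ' h n⟩

/-- Every branch has a rejected step comparable to the returned one; if backtracking accepts 1 at
once, it is `α₀` itself. -/
theorem ForwardBackTracking.spec {α₀ : ℝ} (hh : 0 < h) (hh' : h < 1) (hα₀ : 0 < α₀)
    (H : ForwardBackTracking f x p ρ h α₀ α) :
    Armijo f x p ρ α ∧ 0 < α ∧
      ((α = 1 ∧ ¬ Armijo f x p ρ α₀) ∨ ∃ β, 0 < β ∧ ¬ Armijo f x p ρ β ∧ α = h * β) := by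
  rcases H with ⟨h0, hb⟩ | ⟨n, hn, hn', rfl⟩
  · obtain ⟨h1, h2, -, h3 | ⟨β, h3, -, h4, h5⟩⟩ := hb.spec hh hh'
    · exact ⟨h1, h2, Or.inl ⟨h3, h0⟩⟩
    · exact ⟨h1, h2, Or.inr ⟨β, h3, h4, h5⟩⟩
  · have h1 : h * (α₀ / h ^ (n + 1)) = α₀ / h ^ n := by field_simp; ring
    refine ⟨?_, by positivity, Or.inr ⟨_, by positivity, hn', rfl⟩⟩
    rw [h1]
    exact hn n le_rfl

theorem exists_backTracking (hh : 0 < h) (hh' : h < 1) {a : ℝ} (ha : 0 < a)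
    (H : ∀ α, 0 < α → α < a → Armijo f x p ρ α) : ∃ α, BackTracking f x p ρ h α := by
  classical
  obtain ⟨n, hn⟩ := exists_pow_lt_of_lt_one ha hh'
  have hex : ∃ n : ℕ, Armijo f x p ρ (h ^ n) := ⟨n, H _ (by positivity) hn⟩
  exact ⟨_, Nat.find hex, fun m hm => Nat.find_min hex hm, Nat.find_spec hex, rfl⟩

theorem exists_forwardBackTracking {α₀ : ℝ} (hh : 0 < h) (hh' : h < 1) (hα₀ : 0 < α₀) {a : ℝ}
    (ha : 0 < a) (H : ∀ α, 0 < α → α < a → Armijo f x p ρ α) (hf : BddBelow (Set.range f))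
    (hρ : 0 < ρ) (hp : ⟪gradient f x, p⟫_ℝ < 0) :
    ∃ α, ForwardBackTracking f x p ρ h α₀ α := by
  classical
  by_cases h0 : Armijo f x p ρ α₀
  swap
  · obtain ⟨α, hα⟩ := exists_backTracking hh hh' ha H
    exact ⟨α, Or.inl ⟨h0, hα⟩⟩
  obtain ⟨B, hB⟩ := hf
  -- Accepting every forward step would force decreases growing like h⁻ⁿ, against the lower bound
  -- `B` of f.
  have hex : ∃ n : ℕ, ¬ Armijo f x p ρ (α₀ / h ^ n) := by
    by_contra! hall
    set D := ρ * α₀ * -⟪gradient f x, p⟫_ℝ with hD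
    have hDpos : 0 < D := mul_pos (by positivity) (by linarith)
    obtain ⟨n, hn⟩ := pow_unbounded_of_one_lt ((f x - B) / D) ((one_lt_inv₀ hh).2 hh')
    have h1 := hall n
    have h2 : B ≤ f (x + (α₀ / h ^ n) • p) := hB ⟨_, rfl⟩
    rw [div_lt_iff₀ hDpos] at hn
    have h3 : ρ * (α₀ / h ^ n) * ⟪gradient f x, p⟫_ℝ = -(h⁻¹ ^ n * D) := by
      rw [hD, inv_pow]; field_simp
    rw [Armijo, h3] at h1
    linarith
  obtain ⟨n, hn⟩ : ∃ n, Nat.find hex = n + 1 := by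
    refine Nat.exists_eq_succ_of_ne_zero fun h1 => ?_
    have := Nat.find_spec hex
    rw [h1, pow_zero, div_one] at this
    exact this h0
  refine ⟨_, Or.inr ⟨n, fun m hm => ?_, ?_, rfl⟩⟩
  · exact not_not.1 (Nat.find_min hex (by omega))
  · rw [← hn]; exact Nat.find_spec hex

end LineSearch

/-! ### Decrease of the objective in one step -/

section Decrease

variable {d : ℕ} {f : Vec d → ℝ} {x p : Vec d} {A : Vec d →L[ℝ] Vec d} {M ρ σ ε h : ℝ}

theorem inner_hess_le (hE : ‖hess f x - A‖ ≤ ε) :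
    ⟪p, hess f x p⟫_ℝ ≤ ⟪p, A p⟫_ℝ + ε * ‖p‖ ^ 2 := by
  have h1 : ⟪p, (hess f x - A) p⟫_ℝ ≤ ‖p‖ * (ε * ‖p‖) :=
    (real_inner_le_norm _ _).trans (mul_le_mul_of_nonneg_left
      ((hess f x - A).le_of_opNorm_le hE p) (norm_nonneg p))
  rw [sub_apply, inner_sub_right] at h1
  linarith

theorem le_taylor_inexact (hf : ContDiff ℝ 2 f) (hM : 0 ≤ M) (hlip : HessianLipschitz f M)
    (hE : ‖hess f x - A‖ ≤ ε) {α : ℝ} (hα : 0 ≤ α) :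
    f (x + α • p) ≤ f x + α * ⟪gradient f x, p⟫_ℝ
      + α ^ 2 / 2 * (⟪p, A p⟫_ℝ + ε * ‖p‖ ^ 2) + M * α ^ 3 * ‖p‖ ^ 3 := by
  have h1 := le_taylor_two hf hM hlip x (α • p)
  rw [map_smul, inner_smul_right, inner_smul_right, inner_smul_left, norm_smul,
    Real.norm_of_nonneg hα, RCLike.conj_to_real] at h1
  have h2 := mul_le_mul_of_nonneg_left (inner_hess_le (p := p) hE) (by positivity : 0 ≤ α ^ 2 / 2)
  nlinarith [h1, h2]

/-- The slope G = -⟨g, p⟩ dominates ⟨p, A p⟩, so the quadratic term uses at most αG/2. Of the slack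
α(1/2 - ρ)G ≥ α(1/2 - ρ)σ‖p‖², the Hessian error and the cubic remainder take at most half each. -/
theorem armijo_of_solution (hf : ContDiff ℝ 2 f) (hM : 0 ≤ M) (hlip : HessianLipschitz f M)
    (hE : ‖hess f x - A‖ ≤ ε) (hρ : 0 < ρ) (hρ' : ρ < 1 / 2) (hε : ε ≤ σ * (1 - 2 * ρ) / 2)
    (hg : ⟪gradient f x, p⟫_ℝ ≤ -⟪p, A p⟫_ℝ) (hσ : σ * ‖p‖ ^ 2 ≤ ⟪p, A p⟫_ℝ) (hσ0 : 0 < σ)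
    {α : ℝ} (hα : 0 < α) (hα' : α ≤ 1) (hs : M * α ^ 2 * ‖p‖ ≤ (1 - 2 * ρ) * σ / 4) :
    Armijo f x p ρ α := by
  have h1 := le_taylor_inexact (p := p) hf hM hlip hE hα.le
  set G := -⟪gradient f x, p⟫_ℝ with hG
  set Q := ⟪p, A p⟫_ℝ
  set R := ‖p‖ ^ 2 with hR
  have hR0 : 0 ≤ R := sq_nonneg _
  have hgG : ⟪gradient f x, p⟫_ℝ = -G := by rw [hG]; ring
  rw [Armijo]
  rw [hgG] at h1 ⊢
  have hGQ : Q ≤ G := by linarith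
  have hGR : σ * R ≤ G := hσ.trans hGQ
  have hG0 : 0 ≤ G := le_trans (by positivity) hGR
  have e1 : M * α ^ 3 * ‖p‖ ^ 3 ≤ α * ((1 - 2 * ρ) * σ / 4) * R := by
    have := mul_le_mul_of_nonneg_left hs (mul_nonneg hα.le hR0)
    calc _ = α * R * (M * α ^ 2 * ‖p‖) := by rw [hR]; ring
      _ ≤ _ := this
      _ = _ := by ring
  have e2 : α ^ 2 / 2 * Q ≤ α / 2 * G := by
    have : α ^ 2 ≤ α := by nlinarith
    calc α ^ 2 / 2 * Q ≤ α ^ 2 / 2 * G := mul_le_mul_of_nonneg_left hGQ (by positivity)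
      _ ≤ _ := mul_le_mul_of_nonneg_right (by linarith) hG0
  have hε0 : 0 ≤ ε := (norm_nonneg _).trans hE
  have e3 : α ^ 2 / 2 * (ε * R) ≤ α * (σ * (1 - 2 * ρ) / 4) * R := by
    have : α ^ 2 ≤ α := by nlinarith
    calc α ^ 2 / 2 * (ε * R) ≤ α / 2 * (ε * R) :=
          mul_le_mul_of_nonneg_right (by linarith) (by positivity)
      _ ≤ α / 2 * (σ * (1 - 2 * ρ) / 2 * R) := by gcongr
      _ = _ := by ring
  have e4 : α * (1 / 2 - ρ) * (σ * R) ≤ α * (1 / 2 - ρ) * G :=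
    mul_le_mul_of_nonneg_left hGR (mul_nonneg hα.le (by linarith))
  nlinarith [e1, e2, e3, e4, h1]

/-- The curvature term only helps; the slack α(1 - ρ)‖p‖² is shared equally by the Hessian error and
the cubic remainder. -/
theorem armijo_of_nonpositive_curvature (hf : ContDiff ℝ 2 f) (hM : 0 ≤ M)
    (hlip : HessianLipschitz f M) (hE : ‖hess f x - A‖ ≤ ε)
    (hg : ⟪gradient f x, p⟫_ℝ = -‖p‖ ^ 2) (hnpc : ⟪p, A p⟫_ℝ ≤ 0)
    {α : ℝ} (hα : 0 ≤ α) (hαε : α * ε ≤ 1 - ρ) (hs : M * α ^ 2 * ‖p‖ ≤ (1 - ρ) / 2) :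
    Armijo f x p ρ α := by
  have h1 := le_taylor_inexact (p := p) hf hM hlip hE hα
  rw [Armijo]
  rw [hg] at h1 ⊢
  set R := ‖p‖ ^ 2 with hR
  have hR0 : 0 ≤ R := sq_nonneg _
  have e1 : M * α ^ 3 * ‖p‖ ^ 3 ≤ α * R * ((1 - ρ) / 2) := by
    have := mul_le_mul_of_nonneg_left hs (mul_nonneg hα hR0)
    calc _ = α * R * (M * α ^ 2 * ‖p‖) := by rw [hR]; ring
      _ ≤ _ := this
  have e2 : α * R * (α * ε) ≤ α * R * (1 - ρ) := mul_le_mul_of_nonneg_left hαε (by positivity)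
  have e3 : α ^ 2 / 2 * ⟪p, A p⟫_ℝ ≤ 0 := mul_nonpos_of_nonneg_of_nonpos (by positivity) hnpc
  nlinarith [e1, e2, e3, h1]

/-- A shortened step has a rejected predecessor, which bounds α²‖p‖, and with α ≤ 1 also ‖p‖, below
independently of `e`. A full step decreases f in proportion to ‖p‖², which is enough unless ‖p‖ ≤ c
e. -/
theorem solution_step_decrease (hf : ContDiff ℝ 2 f) (hM : 0 < M) (hlip : HessianLipschitz f M)
    (hE : ‖hess f x - A‖ ≤ ε) (hρ : 0 < ρ) (hρ' : ρ < 1 / 2) (hε : ε ≤ σ * (1 - 2 * ρ) / 2)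
    (hg : ⟪gradient f x, p⟫_ℝ ≤ -⟪p, A p⟫_ℝ) (hσ : σ * ‖p‖ ^ 2 ≤ ⟪p, A p⟫_ℝ) (hσ0 : 0 < σ)
    (hh : 0 < h) (hh' : h < 1) {α c e : ℝ} (hc : 0 < c) (he : 0 < e) (he' : e ≤ 1)
    (hα : BackTracking f x p ρ h α) :
    f (x + α • p) ≤ f x ∧
      (ρ * σ * min ((h ^ 2 * ((1 - 2 * ρ) * σ / (4 * M))) ^ 2) (c ^ 2) * e ^ 3
          ≤ f x - f (x + α • p) ∨ α = 1 ∧ ‖p‖ ≤ c * e) := by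
  obtain ⟨ha, hα0, hα1, hcase⟩ := hα.spec hh hh'
  have hG : σ * ‖p‖ ^ 2 ≤ -⟪gradient f x, p⟫_ℝ := by linarith
  have hdec : ρ * σ * (α * ‖p‖ ^ 2) ≤ f x - f (x + α • p) := by
    rw [Armijo] at ha
    have := mul_le_mul_of_nonneg_left hG (by positivity : 0 ≤ ρ * α)
    linarith
  have hdec0 : 0 ≤ ρ * σ * (α * ‖p‖ ^ 2) := by positivity
  refine ⟨by linarith, ?_⟩
  set b := (1 - 2 * ρ) * σ / (4 * M) with hb
  have hb0 : 0 < b := div_pos (mul_pos (by linarith) hσ0) (by positivity)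
  have he3 : e ^ 3 ≤ 1 := pow_le_one₀ he.le he'
  rcases hcase with rfl | ⟨β, hβ0, hβ1, hβ, rfl⟩
  · by_cases hp : ‖p‖ ≤ c * e
    · exact Or.inr ⟨rfl, hp⟩
    · left
      push Not at hp
      refine le_trans ?_ hdec
      rw [mul_assoc (ρ * σ)]
      refine mul_le_mul_of_nonneg_left ?_ (by positivity)
      calc min ((h ^ 2 * b) ^ 2) (c ^ 2) * e ^ 3 ≤ c ^ 2 * e ^ 2 := by
            refine mul_le_mul (min_le_right _ _) ?_ (by positivity) (by positivity)
            exact pow_le_pow_of_le_one he.le he' (by norm_num)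
        _ = (c * e) ^ 2 := by ring
        _ ≤ ‖p‖ ^ 2 := by gcongr
        _ = 1 * ‖p‖ ^ 2 := by ring
  · left
    refine le_trans ?_ hdec
    rw [mul_assoc (ρ * σ)]
    refine mul_le_mul_of_nonneg_left ?_ (by positivity)
    have h1 : b < β ^ 2 * ‖p‖ := by
      by_contra! hle
      refine hβ (armijo_of_solution hf hM.le hlip hE hρ hρ' hε hg hσ hσ0 hβ0 hβ1 ?_)
      have := mul_le_mul_of_nonneg_left hle hM.le
      rw [hb] at this
      calc _ = M * (β ^ 2 * ‖p‖) := by ring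
        _ ≤ _ := this
        _ = _ := by field_simp
    have h2 : h ^ 2 * b ≤ (h * β) ^ 2 * ‖p‖ := by
      have := mul_le_mul_of_nonneg_left h1.le (sq_nonneg h)
      linarith
    have h3 : h ^ 2 * b ≤ ‖p‖ := by
      refine h2.trans (mul_le_of_le_one_left (norm_nonneg p) ?_)
      exact pow_le_one₀ hα0.le hα1
    -- Here (α‖p‖²)² = (α²‖p‖)‖p‖³, and both factors are bounded below.
    have h4 : ((h ^ 2 * b) ^ 2) ^ 2 ≤ (h * β * ‖p‖ ^ 2) ^ 2 := by
      calc ((h ^ 2 * b) ^ 2) ^ 2 = (h ^ 2 * b) * (h ^ 2 * b) ^ 3 := by ring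
        _ ≤ ((h * β) ^ 2 * ‖p‖) * ‖p‖ ^ 3 := by gcongr
        _ = _ := by ring
    have h5 : (h ^ 2 * b) ^ 2 ≤ h * β * ‖p‖ ^ 2 := le_of_sq_le_sq h4 (by positivity)
    calc min ((h ^ 2 * b) ^ 2) (c ^ 2) * e ^ 3 ≤ (h ^ 2 * b) ^ 2 * 1 :=
          mul_le_mul (min_le_left _ _) he3 (by positivity) (by positivity)
      _ ≤ _ := by linarith

/-- A step size that violates the Armijo condition along a direction of nonpositive curvature is
not too small. -/
theorem le_of_not_armijo (hf : ContDiff ℝ 2 f) (hM : 0 < M)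
    (hlip : HessianLipschitz f M) (hE : ‖hess f x - A‖ ≤ ε)
    (hg : ⟪gradient f x, p⟫_ℝ = -‖p‖ ^ 2) (hnpc : ⟪p, A p⟫_ℝ ≤ 0) (hρ : ρ < 1)
    {ω e β : ℝ} (hσ0 : 0 < σ) (hω : 0 < ω) (he : 0 < e) (hε : ε ≤ e / σ) (hp : ω * e ^ 2 ≤ ‖p‖)
    (hβ0 : 0 < β) (hβ : ¬ Armijo f x p ρ β) :
    min ((1 - ρ) * σ * ω ^ 2) (√((1 - ρ) / (2 * M) * ω ^ 3)) * e ^ 3 ≤ β * ‖p‖ ^ 2 := by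
  have hρ0 : 0 < 1 - ρ := by linarith
  -- Either the Hessian error or the cubic remainder defeated the step. The first gives β ≳ 1/e
  -- against ‖p‖² ≳ e⁴, the second β²‖p‖ ≳ 1 against ‖p‖³ ≳ e⁶; both yield β‖p‖² ≳ e³.
  have hcase : 1 - ρ < β * ε ∨ (1 - ρ) / 2 < M * β ^ 2 * ‖p‖ := by
    by_contra! hle
    exact hβ (armijo_of_nonpositive_curvature hf hM.le hlip hE hg hnpc hβ0.le hle.1 hle.2)
  rcases hcase with h1 | h1
  · have h2 : (1 - ρ) * σ ≤ β * e := by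
      have := h1.le.trans (mul_le_mul_of_nonneg_left hε hβ0.le)
      rwa [← mul_div_assoc, le_div_iff₀ hσ0] at this
    calc _ ≤ (1 - ρ) * σ * ω ^ 2 * e ^ 3 := by gcongr; exact min_le_left _ _
      _ ≤ β * e * ω ^ 2 * e ^ 3 := by gcongr
      _ = β * (ω * e ^ 2) ^ 2 := by ring
      _ ≤ _ := by gcongr
  · have h2 : (1 - ρ) / (2 * M) ≤ β ^ 2 * ‖p‖ := by
      rw [div_le_iff₀ (by positivity)]
      linarith
    refine le_of_sq_le_sq ?_ (by positivity)
    calc _ ≤ (√((1 - ρ) / (2 * M) * ω ^ 3) * e ^ 3) ^ 2 := by gcongr; exact min_le_right _ _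
      _ = (1 - ρ) / (2 * M) * (ω * e ^ 2) ^ 3 := by
          rw [mul_pow, Real.sq_sqrt (by positivity)]; ring
      _ ≤ (β ^ 2 * ‖p‖) * ‖p‖ ^ 3 := by gcongr
      _ = _ := by ring

theorem nonpositive_curvature_step_decrease (hf : ContDiff ℝ 2 f) (hM : 0 < M)
    (hlip : HessianLipschitz f M) (hE : ‖hess f x - A‖ ≤ ε)
    (hg : ⟪gradient f x, p⟫_ℝ = -‖p‖ ^ 2) (hnpc : ⟪p, A p⟫_ℝ ≤ 0) (hρ0 : 0 < ρ) (hρ : ρ < 1)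
    {ω e α₀ α : ℝ} (hσ0 : 0 < σ) (hω : 0 < ω) (he : 0 < e) (hε : ε ≤ e / σ) (hp : ω * e ^ 2 ≤ ‖p‖)
    (hh : 0 < h) (hh' : h < 1) (hα₀ : 0 < α₀) (hα : ForwardBackTracking f x p ρ h α₀ α) :
    ρ * min h α₀⁻¹ * min ((1 - ρ) * σ * ω ^ 2) (√((1 - ρ) / (2 * M) * ω ^ 3)) * e ^ 3
      ≤ f x - f (x + α • p) := by
  obtain ⟨ha, hα0, hcase⟩ := hα.spec hh hh' hα₀
  have key : ∀ β, 0 < β → ¬ Armijo f x p ρ β → _ := fun β hβ0 hβ =>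
    le_of_not_armijo hf hM hlip hE hg hnpc hρ hσ0 hω he hε hp hβ0 hβ
  set k := min ((1 - ρ) * σ * ω ^ 2) (√((1 - ρ) / (2 * M) * ω ^ 3)) with hk
  have hρ1 : 0 < 1 - ρ := by linarith
  have hk0 : 0 ≤ k := le_min (by positivity) (Real.sqrt_nonneg _)
  have hdec : ρ * (α * ‖p‖ ^ 2) ≤ f x - f (x + α • p) := by
    rw [Armijo, hg] at ha
    linarith
  refine le_trans ?_ hdec
  have hbound : min h α₀⁻¹ * (k * e ^ 3) ≤ α * ‖p‖ ^ 2 := by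
    rcases hcase with ⟨rfl, h1⟩ | ⟨β, hβ0, hβ, rfl⟩
    · have h2 := key _ hα₀ h1
      calc _ ≤ α₀⁻¹ * (k * e ^ 3) := by gcongr; exact min_le_right _ _
        _ ≤ α₀⁻¹ * (α₀ * ‖p‖ ^ 2) := by gcongr
        _ = _ := by field_simp
    · have h2 := key _ hβ0 hβ
      calc _ ≤ h * (k * e ^ 3) := by gcongr; exact min_le_left _ _
        _ ≤ h * (β * ‖p‖ ^ 2) := by gcongr
        _ = _ := by ring
  calc _ = ρ * (min h α₀⁻¹ * (k * e ^ 3)) := by ring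
    _ ≤ _ := by gcongr

end Decrease

/-! ### Number of MINRES iterations -/

section IterationCount

variable {d : ℕ} {A : Vec d →L[ℝ] Vec d} {g : Vec d} {L σ : ℝ}

/-- Linear convergence of the residuals of MINRES under Krylov subspace regularity. -/
theorem minres_norm_res_sq_le (hA : ∀ x y : Vec d, ⟪A x, y⟫_ℝ = ⟪x, A y⟫_ℝ) (hL : ‖A‖ ≤ L)
    (hσ : 0 < σ) (hσL : σ ≤ L)
    (hreg : ∀ t, (∀ j < t, ¬ NpcAt A g j) →
      (lanczosMatrix A g t - σ • (1 : Matrix (Fin t) (Fin t) ℝ)).PosSemidef) {n : ℕ}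
    (h : ∀ j < n, ¬ NpcAt A g j) :
    ‖(minresState A g n).res‖ ^ 2 ≤ (1 - σ ^ 2 / L ^ 2) ^ n * ‖g‖ ^ 2 := by
  have hL0 : 0 < L := hσ.trans_le hσL
  have hq : 0 ≤ 1 - σ ^ 2 / L ^ 2 := by
    rw [sub_nonneg, div_le_one (by positivity)]
    gcongr
  induction n with
  | zero => simp [minresState, MinresState.start]
  | succ n ih =>
    have hn : ∀ j < n, ¬ NpcAt A g j := fun j hj => h j (Nat.lt_succ_of_lt hj)
    -- The step σ/L² minimizes 1 - 2aσ + a²L², the bound for the squared contraction factor.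
    have h1 := minres_norm_res_succ_le hA h (σ / L ^ 2)
    have h2 := inner_apply_of_lanczosMatrix_posSemidef hA h (hreg _ h) _ (minres_res_mem hA hn)
    have ih' := ih hn
    set r := (minresState A g n).res
    have h3 : ‖A r‖ ^ 2 ≤ (L * ‖r‖) ^ 2 := by
      have := A.le_of_opNorm_le hL r
      gcongr
    calc ‖(minresState A g (n + 1)).res‖ ^ 2 ≤ ‖r - (σ / L ^ 2) • A r‖ ^ 2 := by gcongr
      _ = ‖r‖ ^ 2 - 2 * (σ / L ^ 2 * ⟪r, A r⟫_ℝ) + (σ / L ^ 2) ^ 2 * ‖A r‖ ^ 2 := by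
          rw [norm_sub_sq_real, inner_smul_right, norm_smul, mul_pow, Real.norm_eq_abs, sq_abs]
      _ ≤ ‖r‖ ^ 2 - 2 * (σ / L ^ 2 * (σ * ‖r‖ ^ 2)) + (σ / L ^ 2) ^ 2 * (L * ‖r‖) ^ 2 := by
          gcongr
      _ = (1 - σ ^ 2 / L ^ 2) * ‖r‖ ^ 2 := by field_simp; ring
      _ ≤ (1 - σ ^ 2 / L ^ 2) * ((1 - σ ^ 2 / L ^ 2) ^ n * ‖g‖ ^ 2) := by gcongr
      _ = _ := by ring

/-- Failure of the inexactness test gives η‖A s‖ ≤ ‖A r‖ ≤ L‖r‖. The right side decays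
geometrically, whereas ‖A s‖² = ‖g‖² - ‖r‖² is at least (σ²/L²)‖g‖² once j ≥ 1. -/
theorem notStoppedBefore_le_pow (hA : ∀ x y : Vec d, ⟪A x, y⟫_ℝ = ⟪x, A y⟫_ℝ) (hL : ‖A‖ ≤ L)
    (hσ : 0 < σ) (hσL : σ ≤ L)
    (hreg : ∀ t, (∀ j < t, ¬ NpcAt A g j) →
      (lanczosMatrix A g t - σ • (1 : Matrix (Fin t) (Fin t) ℝ)).PosSemidef)
    (hg : g ≠ 0) {η : ℝ} (hη : 0 < η) {j : ℕ} (hj : j ≠ 0) (h : NotStoppedBefore A g η (j + 1)) :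
    η ^ 2 * (σ ^ 2 / L ^ 2) ≤ L ^ 2 * (1 - σ ^ 2 / L ^ 2) ^ j := by
  have hL0 : 0 < L := hσ.trans_le hσL
  have hq : 0 ≤ 1 - σ ^ 2 / L ^ 2 := by
    rw [sub_nonneg, div_le_one (by positivity)]
    gcongr
  have hq1 : 1 - σ ^ 2 / L ^ 2 ≤ 1 := by
    have : 0 ≤ σ ^ 2 / L ^ 2 := by positivity
    linarith
  have hn : ∀ i < j, ¬ NpcAt A g i := fun i hi => (h i (Nat.lt_succ_of_lt hi)).2
  have h1 := minres_norm_res_sq_le hA hL hσ hσL hreg hn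
  have h2 := (h j j.lt_succ_self).1
  rw [solAt_iff hA hn, not_lt] at h2
  have h3 := minres_norm_apply_iter_sq hA hn
  rw [← minres_norm_res hA hn] at h3
  have h4 : ‖A (minresState A g j).res‖ ≤ L * ‖(minresState A g j).res‖ :=
    A.le_of_opNorm_le hL _
  have h5 : η ^ 2 * ‖A (minresState A g j).iter‖ ^ 2 ≤ L ^ 2 * ‖(minresState A g j).res‖ ^ 2 := by
    rw [← mul_pow, ← mul_pow]
    have := h2.trans h4
    gcongr
  have h6 : (1 - σ ^ 2 / L ^ 2) ^ j ≤ 1 - σ ^ 2 / L ^ 2 := pow_le_of_le_one hq hq1 hj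
  have hg0 : 0 < ‖g‖ ^ 2 := by positivity
  refine le_of_mul_le_mul_right ?_ hg0
  calc η ^ 2 * (σ ^ 2 / L ^ 2) * ‖g‖ ^ 2
      = η ^ 2 * (‖g‖ ^ 2 - (1 - σ ^ 2 / L ^ 2) * ‖g‖ ^ 2) := by ring
    _ ≤ η ^ 2 * (‖g‖ ^ 2 - ‖(minresState A g j).res‖ ^ 2) := by
        have := h1.trans (mul_le_mul_of_nonneg_right h6 hg0.le)
        gcongr
    _ ≤ L ^ 2 * ‖(minresState A g j).res‖ ^ 2 := by rw [← h3]; exact h5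
    _ ≤ L ^ 2 * ((1 - σ ^ 2 / L ^ 2) ^ j * ‖g‖ ^ 2) := by gcongr
    _ = _ := by ring

/-- A logarithmic bound on the number of iterations of MINRES. -/
theorem notStoppedBefore_le_log (hA : ∀ x y : Vec d, ⟪A x, y⟫_ℝ = ⟪x, A y⟫_ℝ) (hL : ‖A‖ ≤ L)
    (hσ : 0 < σ) (hσL : σ ≤ L)
    (hreg : ∀ t, (∀ j < t, ¬ NpcAt A g j) →
      (lanczosMatrix A g t - σ • (1 : Matrix (Fin t) (Fin t) ℝ)).PosSemidef)
    (hg : g ≠ 0) {θ εg : ℝ} (hθ : 0 < θ) (hεg : 0 < εg) (hεg' : εg ≤ 1) {n : ℕ}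
    (h : NotStoppedBefore A g (θ * √εg) n) :
    (n : ℝ) + 1 ≤ (2 + (|Real.log (L ^ 2 * L ^ 2 / (θ ^ 2 * σ ^ 2))| + 1) * (L ^ 2 / σ ^ 2))
      * (1 + Real.log (1 / εg)) := by
  have hL0 : 0 < L := hσ.trans_le hσL
  have hlog : 0 ≤ Real.log (1 / εg) := Real.log_nonneg ((one_le_div hεg).2 hεg')
  set K := L ^ 2 * L ^ 2 / (θ ^ 2 * σ ^ 2) with hK
  have hK0 : 0 < K := by positivity
  set T := L ^ 2 / σ ^ 2 with hT
  have hT0 : 0 < T := by positivity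
  -- The power bound needs j = n - 1 ≥ 1; the summand 2 of the constant covers smaller n, and below
  -- the offset n + 1 = j + 2.
  rcases Nat.lt_or_ge n 2 with hn | hn
  · have h1 : (n : ℝ) ≤ 1 := by exact_mod_cast Nat.lt_succ_iff.1 hn
    have h2 : 0 ≤ (|Real.log K| + 1) * T := by positivity
    nlinarith [mul_nonneg h2 hlog]
  obtain ⟨j, rfl⟩ : ∃ j, n = j + 1 := ⟨n - 1, by omega⟩
  have h1 := notStoppedBefore_le_pow hA hL hσ hσL hreg hg (by positivity) (by omega) h
  rw [mul_pow, Real.sq_sqrt hεg.le] at h1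
  have hq : 1 - σ ^ 2 / L ^ 2 ≤ Real.exp (-(σ ^ 2 / L ^ 2)) := by
    have := Real.add_one_le_exp (-(σ ^ 2 / L ^ 2))
    linarith
  have hq0 : 0 ≤ 1 - σ ^ 2 / L ^ 2 := by
    rw [sub_nonneg, div_le_one (by positivity)]
    gcongr
  have h2 : (1 - σ ^ 2 / L ^ 2) ^ j ≤ Real.exp (-(j * (σ ^ 2 / L ^ 2))) := by
    refine (pow_le_pow_left₀ hq0 hq j).trans_eq ?_
    rw [← Real.exp_nat_mul]
    congr 1
    ring
  have h3 : Real.exp (j * (σ ^ 2 / L ^ 2)) ≤ K * (1 / εg) := by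
    have h4 := h1.trans (mul_le_mul_of_nonneg_left h2 (by positivity))
    rw [Real.exp_neg, ← div_eq_mul_inv, le_div_iff₀ (Real.exp_pos _)] at h4
    rw [hK, div_mul_div_comm, le_div_iff₀ (by positivity)]
    calc _ = θ ^ 2 * εg * (σ ^ 2 / L ^ 2) * Real.exp (j * (σ ^ 2 / L ^ 2)) * L ^ 2 := by
          field_simp
      _ ≤ L ^ 2 * L ^ 2 := by gcongr
      _ = _ := by ring
  have h4 : (j : ℝ) * (σ ^ 2 / L ^ 2) ≤ Real.log K + Real.log (1 / εg) := by
    rw [← Real.log_mul hK0.ne' (by positivity)]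
    exact (Real.le_log_iff_exp_le (by positivity)).2 h3
  have h5 : (j : ℝ) ≤ (|Real.log K| + Real.log (1 / εg)) * T := by
    calc (j : ℝ) = j * (σ ^ 2 / L ^ 2) * T := by rw [hT]; field_simp
      _ ≤ _ := by
        refine mul_le_mul_of_nonneg_right (h4.trans ?_) hT0.le
        linarith [le_abs_self (Real.log K)]
  push_cast
  have h6 : 0 ≤ |Real.log K| * T * Real.log (1 / εg) := by positivity
  nlinarith [h5, h6]

theorem exists_returns (hA : ∀ x y : Vec d, ⟪A x, y⟫_ℝ = ⟪x, A y⟫_ℝ) (hL : ‖A‖ ≤ L)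
    (hσ : 0 < σ) (hσL : σ ≤ L)
    (hreg : ∀ t, (∀ j < t, ¬ NpcAt A g j) →
      (lanczosMatrix A g t - σ • (1 : Matrix (Fin t) (Fin t) ℝ)).PosSemidef)
    (hg : g ≠ 0) {θ εg : ℝ} (hθ : 0 < θ) (hεg : 0 < εg) (hεg' : εg ≤ 1) :
    ∃ t p, ReturnsSol A g (θ * √εg) t p ∨ ReturnsNpc A g (θ * √εg) t p := by
  classical
  have hex : ∃ t, SolAt A g (θ * √εg) t ∨ NpcAt A g t := by
    by_contra! hall
    obtain ⟨n, hn⟩ := exists_nat_ge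
      ((2 + (|Real.log (L ^ 2 * L ^ 2 / (θ ^ 2 * σ ^ 2))| + 1) * (L ^ 2 / σ ^ 2))
      * (1 + Real.log (1 / εg)))
    have := notStoppedBefore_le_log hA hL hσ hσL hreg hg hθ hεg hεg' (n := n)
      (fun j _ => hall j)
    linarith
  have h1 : NotStoppedBefore A g (θ * √εg) (Nat.find hex) :=
    fun j hj => not_or.1 (Nat.find_min hex hj)
  by_cases h2 : SolAt A g (θ * √εg) (Nat.find hex)
  · exact ⟨_, _, Or.inl ⟨h1, h2, rfl⟩⟩
  · exact ⟨_, _, Or.inr ⟨h1, h2, (Nat.find_spec hex).resolve_left h2, rfl⟩⟩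

/-- If the gradient is not a direction of curvature at least `σ`, MINRES stops in its first
iteration. -/
theorem npcAt_zero_of_inner_lt (hA : ∀ x y : Vec d, ⟪A x, y⟫_ℝ = ⟪x, A y⟫_ℝ)
    (hreg : ∀ t, (∀ j < t, ¬ NpcAt A g j) →
      (lanczosMatrix A g t - σ • (1 : Matrix (Fin t) (Fin t) ℝ)).PosSemidef)
    (h : ⟪g, A g⟫_ℝ < σ * ‖g‖ ^ 2) : NpcAt A g 0 := by
  by_contra h0
  have h1 : ∀ j < 1, ¬ NpcAt A g j := by
    intro j hj
    obtain rfl : j = 0 := by omega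
    exact h0
  -- The initial residual -g lies in the first Krylov space, so T_1 ⪰ σ would bound its curvature.
  have h2 := inner_apply_of_lanczosMatrix_posSemidef hA h1 (hreg 1 h1) _
    (minres_res_mem hA (n := 0) (fun j hj => absurd hj j.not_lt_zero))
  change σ * ‖-g‖ ^ 2 ≤ ⟪-g, A (-g)⟫_ℝ at h2
  rw [norm_neg, map_neg, inner_neg_neg] at h2
  linarith

/-- The initial iterate is zero, so the strict test asks for a negative norm. Hence the inexactness
test never preempts NPC detection in the first iteration. -/
theorem not_solAt_zero (hA : ∀ x y : Vec d, ⟪A x, y⟫_ℝ = ⟪x, A y⟫_ℝ) (η : ℝ) :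
    ¬ SolAt A g η 0 := by
  rw [solAt_iff hA (fun j hj => absurd hj j.not_lt_zero)]
  simp [minresState, MinresState.start]

end IterationCount

/-! ### The gradient after a short full step -/

section SmallStep

variable {d : ℕ} {f : Vec d → ℝ} {x s : Vec d} {A A' : Vec d →L[ℝ] Vec d} {M L ρ σ ε θ e : ℝ}

/-- After a short full step along an inexact solution, the gradient is not a direction of large
curvature unless it is small. -/
theorem inner_gradient_lt_of_small_step (hf : ContDiff ℝ 2 f) (hM : 0 < M)
    (hlip : HessianLipschitz f M) (hE : ‖hess f x - A‖ ≤ ε) (hE' : ‖hess f (x + s) - A'‖ ≤ ε)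
    (hL : ‖A‖ ≤ L) (hρ : 0 < ρ) (hσ : 0 < σ) (hθ : 0 < θ) (he : 0 < e) (he' : e ≤ 1)
    (hε : ε ≤ e / σ) (hε' : ε ≤ σ * (1 - 2 * ρ) / 2)
    (hsol : ‖A (-gradient f x - A s)‖ ≤ θ * e * ‖A s‖)
    (hs : ‖s‖ ≤ σ * ρ / (L * (θ + 1 / σ + M) + M + σ * ρ) * e)
    (hg : e ^ 2 < ‖gradient f (x + s)‖) :
    ⟪gradient f (x + s), A' (gradient f (x + s))⟫_ℝ < σ * ‖gradient f (x + s)‖ ^ 2 := by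
  have hL0 : 0 ≤ L := (norm_nonneg _).trans hL
  have hε0 : 0 ≤ ε := (norm_nonneg _).trans hE
  set c := σ * ρ / (L * (θ + 1 / σ + M) + M + σ * ρ) with hc
  have hc0 : 0 < c := by positivity
  have hc1 : c ≤ 1 := by
    rw [hc, div_le_one (by positivity)]
    have : 0 ≤ L * (θ + 1 / σ + M) + M := by positivity
    linarith
  -- The denominator of `c` is chosen so that all terms proportional to `c` below add up to at most
  -- σρ.
  have hcmul : c * (L * (θ + 1 / σ + M)) + M * c ≤ σ * ρ := by
    have : c * (L * (θ + 1 / σ + M) + M + σ * ρ) = σ * ρ := by rw [hc]; field_simp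
    have : 0 ≤ c * (σ * ρ) := by positivity
    linarith
  set g := gradient f x
  set g' := gradient f (x + s) with hg'
  set N := ‖g'‖ with hN
  have hN0 : 0 < N := lt_trans (by positivity) hg
  have hse : ‖s‖ ≤ e := hs.trans (mul_le_of_le_one_left he.le hc1)
  have hsc : ‖s‖ ≤ c := hs.trans (mul_le_of_le_one_right hc0.le he')
  have hAs : ‖A s‖ ≤ L * ‖s‖ := A.le_of_opNorm_le hL s
  -- Write A g' through the MINRES residual, the Taylor remainder and the Hessian error on s; then
  -- replace A by A' through the two exact Hessians.
  have hdec : A' g' = -A (-g - A s) + A (g' - g - hess f x s) + A ((hess f x - A) s)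
      + (hess f (x + s) - hess f x) g' + (hess f x - A) g' - (hess f (x + s) - A') g' := by
    simp only [map_sub, map_neg, sub_apply]
    abel
  have b1 : ‖A (-g - A s)‖ ≤ θ * e * (L * (c * e)) :=
    hsol.trans (by gcongr; exact hAs.trans (by gcongr))
  have b2 : ‖A (g' - g - hess f x s)‖ ≤ L * (M * (e * (c * e))) := by
    refine (A.le_of_opNorm_le hL _).trans ?_
    have h1 := norm_gradient_sub_le hf hM.le hlip x s
    have h2 : ‖s‖ ^ 2 ≤ e * (c * e) := by rw [sq]; gcongr
    exact mul_le_mul_of_nonneg_left (h1.trans (mul_le_mul_of_nonneg_left h2 hM.le)) hL0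
  have b3 : ‖A ((hess f x - A) s)‖ ≤ L * (e / σ * (c * e)) := by
    refine (A.le_of_opNorm_le hL _).trans ?_
    have h1 := (hess f x - A).le_of_opNorm_le (hE.trans hε) s
    exact mul_le_mul_of_nonneg_left
      (h1.trans (mul_le_mul_of_nonneg_left hs (by positivity))) hL0
  have b4 : ‖(hess f (x + s) - hess f x) g'‖ ≤ M * c * N := by
    refine ContinuousLinearMap.le_of_opNorm_le _ ((hlip _ _).trans ?_) _
    rw [add_sub_cancel_left]
    gcongr
  have b5 : ‖(hess f x - A) g'‖ ≤ ε * N := ContinuousLinearMap.le_of_opNorm_le _ hE _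
  have b6 : ‖(hess f (x + s) - A') g'‖ ≤ ε * N := ContinuousLinearMap.le_of_opNorm_le _ hE' _
  have hnorm : ‖A' g'‖ ≤ θ * e * (L * (c * e)) + L * (M * (e * (c * e)))
      + L * (e / σ * (c * e)) + M * c * N + ε * N + ε * N := by
    rw [hdec]
    refine (norm_sub_le _ _).trans (add_le_add ?_ b6)
    refine (norm_add_le _ _).trans (add_le_add ?_ b5)
    refine (norm_add_le _ _).trans (add_le_add ?_ b4)
    refine (norm_add_le _ _).trans (add_le_add ?_ b3)
    refine (norm_add_le _ _).trans (add_le_add ?_ b2)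
    rw [norm_neg]
    exact b1
  -- The first three terms are O(c e²), and e² < ‖g'‖ makes them relative to the new gradient.
  have hsum : θ * e * (L * (c * e)) + L * (M * (e * (c * e))) + L * (e / σ * (c * e))
      ≤ c * (L * (θ + 1 / σ + M)) * N := by
    calc _ = c * (L * (θ + 1 / σ + M)) * e ^ 2 := by ring
      _ ≤ _ := by gcongr
  -- The two Hessian errors cost 2ε ≤ σ(1 - 2ρ), the rest σρ: in total σ(1 - ρ) < σ.
  have hfin : ‖A' g'‖ < σ * N := by
    have h1 := mul_le_mul_of_nonneg_right hcmul hN0.le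
    have h2 := mul_le_mul_of_nonneg_right hε' hN0.le
    have h3 : 0 < σ * ρ * N := by positivity
    linarith
  calc ⟪g', A' g'⟫_ℝ ≤ N * ‖A' g'‖ := real_inner_le_norm _ _
    _ < N * (σ * N) := by gcongr
    _ = _ := by ring

end SmallStep

/-! ### Amortized step count and the complexity bound -/

section Complexity

variable {d : ℕ}

theorem hbar_symm {f : Vec d → ℝ} (hf : ContDiff ℝ 2 f) {Hbar : Vec d → (Vec d →L[ℝ] Vec d)}
    {ε : ℝ} (hN : NoiseModel f Hbar ε) (x v w : Vec d) :
    ⟪Hbar x v, w⟫_ℝ = ⟪v, Hbar x w⟫_ℝ := by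
  obtain ⟨E, hE⟩ := hN
  obtain ⟨h1, h2, -⟩ := hE x
  have h3 := ContinuousLinearMap.isSelfAdjoint_iff_isSymmetric.1 h2 v w
  rw [h1, add_apply, add_apply, inner_add_left, inner_add_right, hess_symm hf]
  congr 1

theorem norm_hess_sub_hbar_le {f : Vec d → ℝ} {Hbar : Vec d → (Vec d →L[ℝ] Vec d)}
    {ε : ℝ} (hN : NoiseModel f Hbar ε) (x : Vec d) : ‖hess f x - Hbar x‖ ≤ ε := by
  obtain ⟨E, hE⟩ := hN
  obtain ⟨h1, -, h2⟩ := hE x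
  rw [h1, sub_add_cancel_left, norm_neg]
  exact h2

/-- If every nonpositive curvature step decreases the objective by `κ`, and every solution step
does so unless it leads to a point where the algorithm stops or next takes a nonpositive curvature
step, then the number of steps is bounded by twice the total decrease. -/
theorem Reaches.potential (P : NewtonMRInput d) {κ B : ℝ} (hκ : 0 ≤ κ) (Bad : Vec d → Prop)
    (hsol : ∀ (x p : Vec d) (t : ℕ) (α : ℝ), P.εg < ‖gradient P.f x‖ →
      ReturnsSol (P.Hbar x) (gradient P.f x) P.η t p → BackTracking P.f x p P.ρS P.h α →
      (t : ℝ) + 1 ≤ B ∧ ¬ Bad x ∧ P.f (x + α • p) ≤ P.f x ∧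
        (κ ≤ P.f x - P.f (x + α • p) ∨ ‖gradient P.f (x + α • p)‖ ≤ P.εg ∨ Bad (x + α • p)))
    (hnpc : ∀ (m n : ℕ) (x p : Vec d) (t : ℕ) (α : ℝ), Reaches P m n x →
      P.εg < ‖gradient P.f x‖ →
      ReturnsNpc (P.Hbar x) (gradient P.f x) P.η t p →
      ForwardBackTracking P.f x p P.ρN P.h P.α₀ α →
      (t : ℝ) + 1 ≤ B ∧ κ ≤ P.f x - P.f (x + α • p))
    {m n : ℕ} {x : Vec d} (h : Reaches P m n x) :
    (n : ℝ) ≤ (m - 1) * B ∧ ((m - 1) * κ ≤ 2 * (P.f P.x₀ - P.f x) ∨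
      ((m - 2) * κ ≤ 2 * (P.f P.x₀ - P.f x) ∧ (‖gradient P.f x‖ ≤ P.εg ∨ Bad x))) := by
  induction h with
  | first => simp
  | @solStep m n t x p α hx hg hp hα ih =>
    obtain ⟨h1, h2, h3, h4⟩ := hsol x p t α hg hp hα
    obtain ⟨i1, i2⟩ := ih
    push_cast
    refine ⟨by linarith, ?_⟩
    -- The method has not stopped and a solution step cannot start at a `Bad` point, so no step is
    -- still unpaid.
    have i3 : (m - 1) * κ ≤ 2 * (P.f P.x₀ - P.f x) :=
      i2.resolve_right fun ⟨_, h5⟩ => h5.elim (fun h6 => absurd hg (not_lt.2 h6)) h2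
    rcases h4 with h4 | h4
    · left; linarith
    · right; exact ⟨by linarith, h4⟩
  | @npcStep m n t x p α hx hg hp hα ih =>
    obtain ⟨h1, h2⟩ := hnpc m n x p t α hx hg hp hα
    obtain ⟨i1, i2⟩ := ih
    push_cast
    refine ⟨by linarith, Or.inl ?_⟩
    -- An NPC step also pays for a possibly unpaid predecessor; this is the origin of the factor 2.
    rcases i2 with i2 | ⟨i2, -⟩ <;> linarith

/-- Turns the quantitative acceptance criteria into a positive threshold, as termination of the line
searches requires. `R + 1` keeps the denominator positive when `R = 0`. -/
theorem armijo_of_small_step {f : Vec d → ℝ} {M ρ b R : ℝ} (hb : 0 < b)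
    (hM : 0 < M) (hR : 0 ≤ R) {a : ℝ} (ha : 0 < a) {x p : Vec d}
    (H : ∀ α, 0 < α → α ≤ a → α ≤ 1 → M * α ^ 2 * R ≤ b → Armijo f x p ρ α) :
    ∃ a', 0 < a' ∧ ∀ α, 0 < α → α < a' → Armijo f x p ρ α := by
  refine ⟨min (min a 1) (b / (M * (R + 1))), by positivity, fun α h0 h1 => ?_⟩
  have h2 : α < a := h1.trans_le ((min_le_left _ _).trans (min_le_left _ _))
  have h3 : α < 1 := h1.trans_le ((min_le_left _ _).trans (min_le_right _ _))
  have h4 : α ≤ b / (M * (R + 1)) := h1.le.trans (min_le_right _ _)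
  rw [le_div_iff₀ (by positivity)] at h4
  refine H α h0 h2.le h3.le ?_
  calc M * α ^ 2 * R ≤ M * α * (R + 1) := by
        have : α ^ 2 ≤ α := by nlinarith
        gcongr
        linarith
    _ ≤ b := by linarith

end Complexity

theorem mainTheorem3
    (Lg LH σ ω μ δ θ ρS ρN h α₀ : ℝ)
    (hLg : 0 ≤ Lg) (hLH : 0 ≤ LH) (hσ : 0 < σ) (hω : 0 < ω) (hμ : 0 < μ) (hδ : 0 < δ)
    (hθ : 0 < θ) (hρS : 0 < ρS) (hρS' : ρS < 1 / 2) (hρN : 0 < ρN) (hρN' : ρN < 1)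
    (hh : 0 < h) (hh' : h < 1) (hα₀ : 0 < α₀) :
    ∃ C : ℝ, 0 < C ∧ ∃ p : ℕ,
      ∀ (d : ℕ) (f : Vec d → ℝ) (Hbar : Vec d → (Vec d →L[ℝ] Vec d)) (x₀ : Vec d)
        (εg η ε ν : ℝ) (P : NewtonMRInput d),
        0 < εg → εg ≤ 1 → η = θ * √εg →
        P = { f := f, Hbar := Hbar, x₀ := x₀, εg := εg, η := η, ρS := ρS, ρN := ρN,
              h := h, α₀ := α₀ } →
        BddBelow (Set.range f) →
        HessianBounded f Lg → HessianLipschitz f LH →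
        NoiseModel f Hbar ε →
        KrylovRegular f Hbar σ → NpcRegular P ω →
        Lg ^ 2 / (Lg ^ 2 + η ^ 2) < ν → ν ≤ 1 → SpectralRegular f μ ν δ →
        ε ≤ √εg / (η + σ) → ε ≤ σ * (1 - 2 * ρS) / 2 → ε ≤ 1 - ρN →
        ε ≤ √ν * σ / (2 * (√ν + 4 * δ * Lg)) → ε ≤ μ / 2 →
        (∃ (m n : ℕ) (x : Vec d), Reaches P m n x ∧ ‖gradient f x‖ ≤ εg) ∧
        ∀ (m n : ℕ) (x : Vec d), Reaches P m n x →
          (m : ℝ) + (n : ℝ) ≤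
            C * (1 + (f x₀ - ⨅ x, f x)) * εg ^ (-(3 / 2) : ℝ) * (1 + Real.log (1 / εg)) ^ p := by
  have hM : 0 < LH + 1 := by linarith
  have hL : 0 < Lg + σ := by linarith
  have hσL : σ ≤ Lg + σ := by linarith
  -- `M` is positive even for `LH = 0`. Since ε ≤ σ, the constant `L` below bounds the inexact
  -- Hessians, and it also dominates σ.
  obtain ⟨M, hMdef⟩ : ∃ M, M = LH + 1 := ⟨_, rfl⟩
  obtain ⟨L, hLdef⟩ : ∃ L, L = Lg + σ := ⟨_, rfl⟩
  rw [← hMdef] at hM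
  rw [← hLdef] at hL hσL
  have hρS1 : 0 < 1 - 2 * ρS := by linarith
  have hρN1 : 0 < 1 - ρN := by linarith
  obtain ⟨c, hc⟩ : ∃ c, c = σ * ρS / (L * (θ + 1 / σ + M) + M + σ * ρS) := ⟨_, rfl⟩
  have hc0 : 0 < c := by rw [hc]; positivity
  obtain ⟨κS, hκS⟩ : ∃ κS, κS = ρS * σ *
    min ((h ^ 2 * ((1 - 2 * ρS) * σ / (4 * M))) ^ 2) (c ^ 2) := ⟨_, rfl⟩
  obtain ⟨κN, hκN⟩ : ∃ κN, κN = ρN * min h α₀⁻¹ *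
    min ((1 - ρN) * σ * ω ^ 2) (√((1 - ρN) / (2 * M) * ω ^ 3)) := ⟨_, rfl⟩
  have hκS0 : 0 < κS := by rw [hκS]; positivity
  have hκN0 : 0 < κN := by rw [hκN]; positivity
  obtain ⟨κ, hκ⟩ : ∃ κ, κ = min κS κN := ⟨_, rfl⟩
  have hκ0 : 0 < κ := by rw [hκ]; positivity
  obtain ⟨D, hD⟩ : ∃ D, D = 2 + (|Real.log (L ^ 2 * L ^ 2 / (θ ^ 2 * σ ^ 2))| + 1)
    * (L ^ 2 / σ ^ 2) := ⟨_, rfl⟩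
  have hD0 : 0 < D := by rw [hD]; positivity
  -- The factor 2 + 2/κ counts steps and 1 + D the evaluations per step; one power of the logarithm
  -- suffices.
  refine ⟨(2 + 2 / κ) * (1 + D), by positivity, 1, ?_⟩
  intro d f Hbar x₀ εg η ε ν P hεg hεg' hη hP hbdd hbound hlip' hN hreg hnpcreg _ _ _ hε1 hε2 _ _ _
  have hf := hbound.1
  have hlip : HessianLipschitz f M := by
    intro x y
    refine (hlip' x y).trans (mul_le_mul_of_nonneg_right ?_ (norm_nonneg _))
    linarith
  obtain ⟨e, he_def⟩ : ∃ e, e = √εg := ⟨_, rfl⟩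
  have he : 0 < e := by rw [he_def]; positivity
  have hee : e ^ 2 = εg := by rw [he_def, Real.sq_sqrt hεg.le]
  have he' : e ≤ 1 := by rw [he_def]; exact Real.sqrt_le_one.2 hεg'
  have hη0 : 0 < η := by rw [hη]; positivity
  have hε : ε ≤ e / σ := by
    rw [← he_def] at hε1
    refine hε1.trans ?_
    gcongr
    linarith
  have hE := norm_hess_sub_hbar_le hN
  have hε0 : 0 ≤ ε := (norm_nonneg _).trans (hE x₀)
  have hA := hbar_symm hf hN
  have hnorm : ∀ x, ‖Hbar x‖ ≤ L := by
    intro x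
    have h1 : Hbar x = hess f x - (hess f x - Hbar x) := by abel
    rw [h1]
    refine (norm_sub_le _ _).trans ?_
    have h2 := hbound.2 x
    have h3 := hE x
    have h4 : σ * (1 - 2 * ρS) / 2 ≤ σ := by
      have : 0 < σ * ρS := by positivity
      linarith
    linarith
  have hκe : κ * e ^ 3 ≤ κS * e ^ 3 ∧ κ * e ^ 3 ≤ κN * e ^ 3 := by
    rw [hκ]
    constructor
    · gcongr; exact min_le_left _ _
    · gcongr; exact min_le_right _ _
  have hne : ∀ x, εg < ‖gradient f x‖ → gradient f x ≠ 0 := by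
    intro x hx h0
    rw [h0, norm_zero] at hx
    linarith
  have hcount : ∀ x, εg < ‖gradient f x‖ → ∀ t,
      NotStoppedBefore (Hbar x) (gradient f x) η t →
        (t : ℝ) + 1 ≤ D * (1 + Real.log (1 / εg)) := by
    intro x hx t ht
    rw [hη] at ht
    rw [hD]
    exact notStoppedBefore_le_log (hA x) (hnorm x) hσ hσL (hreg x) (hne x hx) hθ hεg hεg' ht
  have hsolspec : ∀ (x p : Vec d) (t : ℕ), ReturnsSol (Hbar x) (gradient f x) η t p →
      ⟪gradient f x, p⟫_ℝ ≤ -⟪p, Hbar x p⟫_ℝ ∧ σ * ‖p‖ ^ 2 ≤ ⟪p, Hbar x p⟫_ℝ ∧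
        ‖Hbar x (-gradient f x - Hbar x p)‖ ≤ θ * e * ‖Hbar x p‖ := by
    rintro x p t ⟨h1, h2, rfl⟩
    have h3 : ∀ j < t, ¬ NpcAt (Hbar x) (gradient f x) j := fun j hj => (h1 j hj).2
    refine ⟨minres_inner_iter (hA x) h3, ?_, ?_⟩
    · exact inner_apply_of_lanczosMatrix_posSemidef (hA x) h3 (hreg x t h3) _
        (minres_iter_mem (hA x) h3)
    · rw [← minres_res_eq (hA x) h3, he_def, ← hη]
      exact ((solAt_iff (hA x) h3).1 h2).le
  have hnpcspec : ∀ (x p : Vec d) (t : ℕ), ReturnsNpc (Hbar x) (gradient f x) η t p →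
      ⟪gradient f x, p⟫_ℝ = -‖p‖ ^ 2 ∧ ⟪p, Hbar x p⟫_ℝ ≤ 0 := by
    rintro x p t ⟨h1, -, h2, rfl⟩
    have h3 : ∀ j < t, ¬ NpcAt (Hbar x) (gradient f x) j := fun j hj => (h1 j hj).2
    exact ⟨minres_inner_res (hA x) h3, inner_res_apply_res_nonpos (hA x) h3 h2⟩
  have hpot : ∀ (m n : ℕ) (x : Vec d), Reaches P m n x →
      (n : ℝ) ≤ (m - 1) * (D * (1 + Real.log (1 / εg))) ∧
        (m - 2) * (κ * e ^ 3) ≤ 2 * (f x₀ - f x) := by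
    intro m n x hx
    -- Take as `Bad` the points where the gradient has curvature below σ.
    have h1 := Reaches.potential P (κ := κ * e ^ 3) (B := D * (1 + Real.log (1 / εg)))
      (by positivity)
      (fun x => ⟪gradient f x, Hbar x (gradient f x)⟫_ℝ < σ * ‖gradient f x‖ ^ 2) ?_ ?_ hx
    · subst hP
      refine ⟨h1.1, ?_⟩
      rcases h1.2 with h2 | ⟨h2, -⟩
      · have : 0 < κ * e ^ 3 := by positivity
        change _ ≤ 2 * (f x₀ - f x) at h2
        linarith
      · exact h2
    · subst hP
      intro x p t α hg hp hα
      obtain ⟨s1, s2, s3⟩ := hsolspec x p t hp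
      obtain ⟨s4, s5⟩ := solution_step_decrease hf hM hlip (hE x) hρS hρS' hε2 s1 s2 hσ hh hh'
        hc0 he he' hα
      refine ⟨hcount x hg t hp.1, fun hbad => ?_, s4, ?_⟩
      · have h0 := npcAt_zero_of_inner_lt (hA x) (hreg x) hbad
        -- At a bad point NPC is detected in iteration 1, where the inexactness test fails; SOL can
        -- be returned neither then nor later.
        rcases Nat.eq_zero_or_pos t with rfl | ht
        · exact not_solAt_zero (hA x) η hp.2.1
        · exact (hp.1 0 ht).2 h0
      · rcases s5 with s5 | ⟨rfl, s5⟩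
        · left
          rw [← hκS] at s5
          exact hκe.1.trans s5
        · right
          rw [one_smul]
          refine or_iff_not_imp_left.2 fun hg' => ?_
          have hg'' : e ^ 2 < ‖gradient f (x + p)‖ := by rw [hee]; exact not_le.1 hg'
          rw [hc] at s5
          exact inner_gradient_lt_of_small_step hf hM hlip (hE x) (hE _) (hnorm x) hρS hσ hθ he he'
            hε hε2 s3 s5 hg''
    · intro m n x p t α hx hg hp hα
      have hp' : ω * e ^ 2 ≤ ‖p‖ := by
        refine le_trans ?_ (hnpcreg m n t x p hx hg hp)
        rw [hee]
        subst hP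
        exact mul_le_mul_of_nonneg_left (le_of_lt hg) hω.le
      subst hP
      obtain ⟨s1, s2⟩ := hnpcspec x p t hp
      refine ⟨hcount x hg t hp.1, hκe.2.trans ?_⟩
      rw [hκN]
      exact nonpositive_curvature_step_decrease hf hM hlip (hE x) s1 s2 hρN hρN' hσ hω he hε hp'
        hh hh' hα₀ hα
  have hinf : ∀ x, ⨅ x, f x ≤ f x := fun x => ciInf_le hbdd x
  have hm : ∀ (m n : ℕ) (x : Vec d), Reaches P m n x →
      (m : ℝ) ≤ 2 + 2 * (f x₀ - ⨅ x, f x) / (κ * e ^ 3) := by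
    intro m n x hx
    have h1 := (hpot m n x hx).2
    have h2 : (m - 2 : ℝ) ≤ 2 * (f x₀ - ⨅ x, f x) / (κ * e ^ 3) := by
      rw [le_div_iff₀ (by positivity)]
      linarith [hinf x]
    linarith
  constructor
  -- Without termination, MINRES and the line searches always return, so arbitrarily many steps
  -- occur, against `hm`.
  · by_contra! hall
    have hstep : ∀ (m n : ℕ) (x : Vec d), Reaches P m n x →
        ∃ n' x', Reaches P (m + 1) n' x' := by
      intro m n x hx
      have hg := hall m n x hx
      obtain ⟨t, p, hp | hp⟩ := exists_returns (hA x) (hnorm x) hσ hσL (hreg x) (hne x hg) hθ hεg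
        hεg'
      · rw [← hη] at hp
        obtain ⟨s1, s2, -⟩ := hsolspec x p t hp
        obtain ⟨a, ha, hsmall⟩ := armijo_of_small_step (ρ := ρS) (x := x) (p := p)
          (b := (1 - 2 * ρS) * σ / 4) (by positivity) hM (norm_nonneg p) one_pos
          fun α a1 _ a2 a3 => armijo_of_solution hf hM.le hlip (hE x) hρS hρS' hε2 s1 s2 hσ a1 a2 a3
        obtain ⟨α, hα⟩ := exists_backTracking hh hh' ha hsmall
        subst hP
        exact ⟨_, _, Reaches.solStep hx hg hp hα⟩
      · rw [← hη] at hp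
        obtain ⟨s1, s2⟩ := hnpcspec x p t hp
        have hppos : 0 < ‖p‖ := by
          refine lt_of_lt_of_le ?_ (hnpcreg m n t x p hx (by subst hP; exact hg)
            (by subst hP; exact hp))
          subst hP
          exact mul_pos hω (hεg.trans hg)
        obtain ⟨a, ha, hsmall⟩ := armijo_of_small_step (ρ := ρN) (x := x) (p := p)
          (b := (1 - ρN) / 2) (by positivity) hM (norm_nonneg p) (a := (1 - ρN) / (ε + 1))
          (by positivity) fun α a1 a2 _ a3 =>
            armijo_of_nonpositive_curvature hf hM.le hlip (hE x) s1 s2 a1.le (by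
              rw [le_div_iff₀ (by positivity)] at a2
              linarith) a3
        obtain ⟨α, hα⟩ := exists_forwardBackTracking hh hh' hα₀ ha hsmall hbdd hρN
          (by rw [s1, neg_lt_zero]; positivity)
        subst hP
        exact ⟨_, _, Reaches.npcStep hx hg hp hα⟩
    have hlong : ∀ m : ℕ, ∃ n x, Reaches P (m + 1) n x := by
      intro m
      induction m with
      | zero => exact ⟨0, _, Reaches.first⟩
      | succ m ih =>
        obtain ⟨n, x, hx⟩ := ih
        exact hstep _ _ _ hx
    obtain ⟨m, hm'⟩ := exists_nat_ge (2 + 2 * (f x₀ - ⨅ x, f x) / (κ * e ^ 3))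
    obtain ⟨n, x, hx⟩ := hlong m
    have := hm _ _ _ hx
    push_cast at this
    linarith
  · intro m n x hx
    have h1 := hm m n x hx
    have h2 := (hpot m n x hx).1
    have hΔ : 0 ≤ f x₀ - ⨅ x, f x := sub_nonneg.2 (hinf x₀)
    set Δ := f x₀ - ⨅ x, f x
    have hlog : 0 ≤ Real.log (1 / εg) := Real.log_nonneg ((one_le_div hεg).2 hεg')
    set ℓ := Real.log (1 / εg)
    have hpow : εg ^ (-(3 / 2) : ℝ) = (e ^ 3)⁻¹ := by
      rw [Real.rpow_neg hεg.le, he_def, Real.sqrt_eq_rpow, ← Real.rpow_natCast,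
        ← Real.rpow_mul hεg.le]
      norm_num
    have he3 : 1 ≤ (e ^ 3)⁻¹ := (one_le_inv₀ (by positivity)).2 (pow_le_one₀ he.le he')
    rw [hpow, pow_one]
    set E := (e ^ 3)⁻¹ with hEdef
    have h3 : (m : ℝ) ≤ (2 + 2 / κ) * (1 + Δ) * E := by
      have h4 : 2 * Δ / (κ * e ^ 3) = 2 / κ * Δ * E := by rw [hEdef]; field_simp
      rw [h4] at h1
      have h5 : 0 ≤ 2 / κ * E := by positivity
      have h6 : 0 ≤ 2 * Δ * E := by positivity
      calc (m : ℝ) ≤ 2 * E + 2 / κ * Δ * E := by linarith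
        _ ≤ _ := by linarith
    have hm0 : (0 : ℝ) ≤ m := Nat.cast_nonneg m
    calc (m : ℝ) + n ≤ m + (m - 1) * (D * (1 + ℓ)) := by linarith
      _ ≤ m * ((1 + D) * (1 + ℓ)) := by
        have h5 : 0 ≤ D * (1 + ℓ) := by positivity
        have h6 : 0 ≤ m * ℓ := by positivity
        linarith
      _ ≤ (2 + 2 / κ) * (1 + Δ) * E * ((1 + D) * (1 + ℓ)) := by gcongr
      _ = _ := by ring
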